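/- Let $R=\mathbb{Z}[x]$ and let $\widehat R=\varprojlim_I R/I$ be its profinite completion, the inverse limit over all ideals $I$ of finite index. It is given the inverse limit topology of the discrete finite rings $R/I$; then $\widehat R$, $\widehat R^{n}$ and $\widehat R^{n\times n}$ are compact additive groups, and $\operatorname{Haar}(\cdot)$ denotes their Haar probability measure. Fix a prime $p$. For a monic $\beta\in\mathbb{Z}[x]$ whose reduction modulo $p$ is irreducible in $\mathbb{F}_p[x]$, let $R_{p,\beta}$ be the completion of $R$ at the maximal ideal $(p,\beta)$, viewed as an $\widehat R$-algebra through the canonical map $\widehat R\to R_{p,\beta}$. An $\widehat R$-module $\mathcal M$ satisfies condition $\mathcal W_p$ if one of the following holds: (W1) $\mathcal M\otimes_{\widehat R}R_{p,\beta}\cong 0$ for every monic $\beta\in\mathbb{Z}[x]$ with irreducible reduction in $\mathbb{F}_p[x]$; (W2) there is $a\in\mathbb{Z}$ such that $\mathcal M\otimes_{\widehat R}R_{p,x-a}\cong \mathbb{F}_p[x]/(x-a)\mathbb{F}_p[x]$ as $\widehat R$-modules, and $\mathcal M\otimes_{\widehat R}R_{p,\beta}\cong 0$ for every monic $\beta\in\mathbb{Z}[x]$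 with irreducible reduction in $\mathbb{F}_p[x]$ and $\beta\not\equiv x-a \bmod p$. For a matrix $\mathbf X\in\widehat R^{n\times m}$ put $\operatorname{coker}(\mathbf X)=\widehat R^n/\mathbf X\widehat R^m$. **Theorem.** For every $n$ let $\mathbf M\sim\operatorname{Haar}(\widehat R^{n\times n})$ and $\zeta\sim\operatorname{Haar}(\widehat R^n)$ be independent (no symmetry is imposed on $\mathbf M$). Then, for every fixed prime $p$, with $(\mathbf M-x\mathbf I,\zeta)$ the $n\times(n+1)$ matrix obtained by appending the column $\zeta$, $$\lim_{n\to\infty}\mathbb P\bigl(\operatorname{coker}(\mathbf M-x\mathbf I,\zeta)\text{ satisfies condition }\mathcal W_p\bigr)=\Bigl(1+\frac1p\Bigr)\prod_{i=1}^\infty\Bigl(1-\frac1{p^i}\Bigr).$$ Here the event is measurable (with respect to the completed probability measure) for every $n$, and the infinite product converges. -/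

import Mathlib

open Polynomial MeasureTheory ProbabilityTheory Filter Topology
open scoped TensorProduct

/-! ### Profinite completion of a commutative ring -/

/-- The ideals `I` of `R` for which `R ⧸ I` is finite. -/
abbrev FiniteIndexIdeal (R : Type*) [CommRing R] : Type _ := {I : Ideal R // Finite (R ⧸ I)}

/-- The families `(r_I)` in `∏ R ⧸ I`, over the ideals `I` of finite index, that are compatible
with the quotient maps `R ⧸ I → R ⧸ J` for `I ≤ J`, as a subring of the product. -/
def compatibleFamilies (R : Type*) [CommRing R] :
    Subring (∀ I : FiniteIndexIdeal R, R ⧸ I.1) where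
  carrier := {r | ∀ (I J : FiniteIndexIdeal R) (h : I.1 ≤ J.1),
    Ideal.Quotient.factor h (r I) = r J}
  mul_mem' ha hb I J h := by simp [ha I J h, hb I J h]
  one_mem' I J h := by simp
  add_mem' ha hb I J h := by simp [ha I J h, hb I J h]
  zero_mem' I J h := by simp
  neg_mem' ha I J h := by simp [ha I J h]

/-- The profinite completion of a commutative ring: the inverse limit of its finite quotients. -/
def ProfiniteCompletion (R : Type*) [CommRing R] : Type _ := compatibleFamilies R

namespace ProfiniteCompletion

variable (R : Type*) [CommRing R]

noncomputable instance : CommRing (ProfiniteCompletion R) :=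
  inferInstanceAs (CommRing (compatibleFamilies R))

variable {R}

/-- The projection of the profinite completion to the finite quotient `R ⧸ I`. -/
noncomputable def proj (I : FiniteIndexIdeal R) : ProfiniteCompletion R →+* R ⧸ I.1 :=
  (Pi.evalRingHom (fun I : FiniteIndexIdeal R => R ⧸ I.1) I).comp (compatibleFamilies R).subtype

theorem factor_proj (I J : FiniteIndexIdeal R) (h : I.1 ≤ J.1) (r : ProfiniteCompletion R) :
    Ideal.Quotient.factor h (proj I r) = proj J r :=
  r.2 I J h

/-- The canonical ring homomorphism from `R` to its profinite completion. -/
noncomputable def of : R →+* ProfiniteCompletion R :=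
  (RingHom.pi fun I : FiniteIndexIdeal R => Ideal.Quotient.mk I.1).codRestrict
    (compatibleFamilies R) fun _ _ _ _ => rfl

/-- The projections, bundled as a map to the product of the finite quotients. -/
noncomputable def toPi (r : ProfiniteCompletion R) (I : FiniteIndexIdeal R) : R ⧸ I.1 := proj I r

theorem toPi_injective : Function.Injective (toPi (R := R)) := Subtype.val_injective

theorem range_toPi : Set.range (toPi (R := R)) =
    {r | ∀ (I J : FiniteIndexIdeal R) (h : I.1 ≤ J.1),
      Ideal.Quotient.factor h (r I) = r J} :=
  Subtype.range_val

variable (R)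

/-- The topology induced by the product topology, where each finite quotient `R ⧸ I` is
discrete. -/
noncomputable instance : TopologicalSpace (ProfiniteCompletion R) :=
  TopologicalSpace.induced toPi (@Pi.topologicalSpace _ _ fun _ => ⊥)

/-- The Borel sigma-algebra. -/
noncomputable instance : MeasurableSpace (ProfiniteCompletion R) := borel _

instance : BorelSpace (ProfiniteCompletion R) := ⟨rfl⟩

section

attribute [local instance] discreteTopology_bot

instance : CompactSpace (ProfiniteCompletion R) := by
  let (I : FiniteIndexIdeal R) : TopologicalSpace (R ⧸ I.1) := ⊥
  have (I : FiniteIndexIdeal R) : Finite (R ⧸ I.1) := I.2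
  have hind : IsInducing (toPi (R := R)) := ⟨rfl⟩
  have hclosed : IsClosed (Set.range (toPi (R := R))) := by
    rw [range_toPi]
    simp only [Set.ofPred_forall]
    refine isClosed_iInter fun I => isClosed_iInter fun J => isClosed_iInter fun h => ?_
    exact isClosed_eq (continuous_of_discreteTopology.comp (continuous_apply I))
      (continuous_apply J)
  exact (Topology.IsClosedEmbedding.mk ⟨hind, toPi_injective⟩ hclosed).compactSpace

instance : T2Space (ProfiniteCompletion R) := by
  let (I : FiniteIndexIdeal R) : TopologicalSpace (R ⧸ I.1) := ⊥
  have hind : IsInducing (toPi (R := R)) := ⟨rfl⟩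
  exact (Topology.IsEmbedding.mk hind toPi_injective).t2Space

instance : IsTopologicalRing (ProfiniteCompletion R) := by
  let (I : FiniteIndexIdeal R) : TopologicalSpace (R ⧸ I.1) := ⊥
  have hind : IsInducing (toPi (R := R)) := ⟨rfl⟩
  have hcont : Continuous (toPi (R := R)) := hind.continuous
  exact
    { continuous_add := hind.continuous_iff.mpr
        ((hcont.comp continuous_fst).add (hcont.comp continuous_snd))
      continuous_mul := hind.continuous_iff.mpr
        ((hcont.comp continuous_fst).mul (hcont.comp continuous_snd))
      continuous_neg := hind.continuous_iff.mpr hcont.neg }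

instance [Countable R] [IsNoetherianRing R] :
    SecondCountableTopology (ProfiniteCompletion R) := by
  let (I : FiniteIndexIdeal R) : TopologicalSpace (R ⧸ I.1) := ⊥
  have (I : FiniteIndexIdeal R) : Finite (R ⧸ I.1) := I.2
  have hind : IsInducing (toPi (R := R)) := ⟨rfl⟩
  have : Countable (Ideal R) :=
    Function.Surjective.countable (f := fun s : Finset R => Ideal.span (s : Set R))
      fun I => (IsNoetherian.noetherian I)
  exact hind.secondCountableTopology

end

variable {R}

/-- The powers of an ideal of finite index in a Noetherian ring, as ideals of finite index. -/
abbrev powIdeal [IsNoetherianRing R] (m : Ideal R) [Finite (R ⧸ m)] (k : ℕ) : FiniteIndexIdeal R :=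
  ⟨m ^ k, Ideal.finite_quotient_pow (IsNoetherian.noetherian m) k⟩

/-- For an ideal `m` of finite index, the canonical ring homomorphism from the profinite
completion to the `m`-adic completion, `(r_I) ↦ (r_{m ^ k})`. -/
noncomputable def toAdicCompletion [IsNoetherianRing R] (m : Ideal R) [Finite (R ⧸ m)] :
    ProfiniteCompletion R →+* AdicCompletion m R :=
  AdicCompletion.liftRingHom m (fun k => proj (powIdeal m k))
    fun {j k} hle => RingHom.ext fun r =>
      factor_proj (powIdeal m k) (powIdeal m j) (Ideal.pow_le_pow_right hle) r

end ProfiniteCompletion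

/-! ### Haar probability measures -/

/-- The Haar probability measure on a compact additive topological group. -/
noncomputable def haarProbability (G : Type*) [AddGroup G] [TopologicalSpace G]
    [IsTopologicalAddGroup G] [CompactSpace G] [MeasurableSpace G] [BorelSpace G] : Measure G :=
  Measure.addHaarMeasure ⊤

/-- Matrices over the profinite completion carry the product sigma-algebra. -/
noncomputable instance {R : Type*} [CommRing R] {m n : Type*} :
    MeasurableSpace (Matrix m n (ProfiniteCompletion R)) :=
  inferInstanceAs (MeasurableSpace (m → n → ProfiniteCompletion R))

instance {R : Type*} [CommRing R] [Countable R] [IsNoetherianRing R] {m n : Type*}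
    [Countable m] [Countable n] : BorelSpace (Matrix m n (ProfiniteCompletion R)) :=
  inferInstanceAs (BorelSpace (m → n → ProfiniteCompletion R))

instance {R : Type*} [CommRing R] {m n : Type*} :
    CompactSpace (Matrix m n (ProfiniteCompletion R)) :=
  inferInstanceAs (CompactSpace (m → n → ProfiniteCompletion R))

instance : Countable ℤ[X] := by
  rw [← Cardinal.mk_le_aleph0_iff]
  exact Polynomial.cardinalMk_le_max.trans (by simp)

/-! ### The local pieces at the maximal ideals `(p, β)` of `ℤ[X]` -/

/-- A monic polynomial `β ∈ ℤ[X]` whose reduction modulo `p` is irreducible. -/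
structure IrredModPoly (p : ℕ) where
  /-- The polynomial `β`. -/
  poly : ℤ[X]
  monic : poly.Monic
  irreducible : Irreducible (poly.map (Int.castRingHom (ZMod p)))

namespace IrredModPoly

variable {p : ℕ}

/-- The reduction of `β` modulo `p`. -/
noncomputable def reduction (β : IrredModPoly p) : (ZMod p)[X] :=
  β.poly.map (Int.castRingHom (ZMod p))

/-- The polynomial `X - a`, for an integer `a`. -/
noncomputable def linear (p : ℕ) [Fact p.Prime] (a : ℤ) : IrredModPoly p where
  poly := X - C a
  monic := monic_X_sub_C a
  irreducible := by
    simpa using irreducible_X_sub_C (Int.castRingHom (ZMod p) a)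

/-- The ideal `(p, β)` of `ℤ[X]`. -/
noncomputable def ideal (β : IrredModPoly p) : Ideal ℤ[X] := Ideal.span {C (p : ℤ), β.poly}

instance [Fact p.Prime] (β : IrredModPoly p) : Finite (ℤ[X] ⧸ β.ideal) := by
  have : Module.Finite ℤ (ℤ[X] ⧸ Ideal.span {β.poly}) := β.monic.finite_quotient
  have hle : Ideal.span {β.poly} ≤ β.ideal := Ideal.span_mono (by simp)
  have : Module.Finite ℤ (ℤ[X] ⧸ β.ideal) :=
    Module.Finite.of_surjective (Ideal.Quotient.factor hle).toAddMonoidHom.toIntLinearMap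
      (Ideal.Quotient.factor_surjective hle)
  refine Module.finite_of_fg_torsion _ fun {x} => ?_
  refine ⟨⟨(p : ℤ), mem_nonZeroDivisors_of_ne_zero ?_⟩, ?_⟩
  · exact_mod_cast (Fact.out : p.Prime).ne_zero
  · obtain ⟨f, rfl⟩ := Ideal.Quotient.mk_surjective x
    have hmem : C (p : ℤ) * f ∈ β.ideal :=
      Ideal.mul_mem_right _ _ (Ideal.subset_span (by simp))
    have h0 := Ideal.Quotient.eq_zero_iff_mem.mpr hmem
    rw [map_mul] at h0
    simpa [Submonoid.smul_def] using h0

/-- The ring `R_{p,β}`: the completion of `ℤ[X]` at the maximal ideal `(p, β)`. -/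
abbrev LocalRing (β : IrredModPoly p) : Type := AdicCompletion β.ideal ℤ[X]

noncomputable instance [Fact p.Prime] (β : IrredModPoly p) :
    Algebra (ProfiniteCompletion ℤ[X]) β.LocalRing :=
  (ProfiniteCompletion.toAdicCompletion β.ideal).toAlgebra

/-- The field `𝔽_p[X] / β 𝔽_p[X]`. -/
abbrev Residue (β : IrredModPoly p) : Type := (ZMod p)[X] ⧸ Ideal.span {β.reduction}

/-- Reduction modulo `p`, as a map `ℤ[X] / (p, β) → 𝔽_p[X] / β 𝔽_p[X]`. -/
noncomputable def toResidue (β : IrredModPoly p) : ℤ[X] ⧸ β.ideal →+* β.Residue :=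
  Ideal.Quotient.lift β.ideal
    ((Ideal.Quotient.mk (Ideal.span {β.reduction})).comp
      (mapRingHom (Int.castRingHom (ZMod p)))) <| by
    intro f hf
    rw [← RingHom.mem_ker]
    refine (Ideal.span_le.mpr ?_ : β.ideal ≤ _) hf
    rintro g (rfl | rfl)
    · have h0 : mapRingHom (Int.castRingHom (ZMod p)) (C (p : ℤ)) = 0 := by
        rw [coe_mapRingHom, map_C]
        simp
      rw [SetLike.mem_coe, RingHom.mem_ker, RingHom.comp_apply, h0, map_zero]
    · exact Ideal.Quotient.eq_zero_iff_mem.mpr (Ideal.subset_span rfl)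

/-- `𝔽_p[X] / β 𝔽_p[X]` is an algebra over the profinite completion of `ℤ[X]`, through the
projection to `ℤ[X] / (p, β)`. -/
noncomputable instance [Fact p.Prime] (β : IrredModPoly p) :
    Algebra (ProfiniteCompletion ℤ[X]) β.Residue :=
  (β.toResidue.comp (ProfiniteCompletion.proj ⟨β.ideal, inferInstance⟩)).toAlgebra

end IrredModPoly

/-! ### Condition `W_p` and cokernels -/

/-- Condition `W_p` on a module over the profinite completion of `ℤ[X]`. -/
def ConditionW (p : ℕ) [Fact p.Prime] (M : Type*) [AddCommGroup M]
    [Module (ProfiniteCompletion ℤ[X]) M] : Prop :=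
  (∀ β : IrredModPoly p, Subsingleton (M ⊗[ProfiniteCompletion ℤ[X]] β.LocalRing)) ∨
  ∃ a : ℤ,
    Nonempty ((M ⊗[ProfiniteCompletion ℤ[X]] (IrredModPoly.linear p a).LocalRing)
      ≃ₗ[ProfiniteCompletion ℤ[X]] (IrredModPoly.linear p a).Residue) ∧
    ∀ β : IrredModPoly p, β.reduction ≠ (IrredModPoly.linear p a).reduction →
      Subsingleton (M ⊗[ProfiniteCompletion ℤ[X]] β.LocalRing)

/-- The cokernel `S^m / A S^n` of a matrix `A ∈ S^{m × n}`. -/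
abbrev Matrix.Cokernel {S : Type*} [CommRing S] {m n : Type*} [Fintype n]
    (A : Matrix m n S) : Type _ :=
  (m → S) ⧸ LinearMap.range A.mulVecLin

/-- The `n × (n + 1)` matrix `(M - x I, ζ)` over the profinite completion of `ℤ[X]`. -/
noncomputable def walkMatrix {n : ℕ} (M : Matrix (Fin n) (Fin n) (ProfiniteCompletion ℤ[X]))
    (ζ : Fin n → ProfiniteCompletion ℤ[X]) :
    Matrix (Fin n) (Fin n ⊕ Unit) (ProfiniteCompletion ℤ[X]) :=
  Matrix.fromCols (M - ProfiniteCompletion.of (X : ℤ[X]) • 1) (Matrix.replicateCol Unit ζ)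

/-! Condition W_p only sees the completions at the maximal ideals 𝔪 = (p, β), one for each monic
irreducible g in 𝔽_p[x]. Tensoring is right exact, so the local piece is the cokernel of the same
matrix over the completion (`baseChangeEquiv`). By Nakayama, both "the cokernel is zero" and "the
cokernel is the residue field 𝔽_p" can be read off modulo 𝔪² (`subsingleton_tensor_iff`,
`nonempty_tensor_equiv_iff`). Modulo 𝔪² the matrix is uniform, the shift by xI being a translation,
and by the Chinese remainder theorem the reductions at finitely many g are independent.

With q = p^{deg g}, an n × (n+1) matrix is surjective with probability ∏_{i=2}^{n+1} (1 - q^{-i}).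
Multiplying over all g, the Euler product ∏_g (1 - t^{deg g}) = 1 - pt at t = p^{-i} turns this into
∏_{i=1}^{n} (1 - p^{-i}), the probability of (W1) (`tendsto_prod_one_sub_pow_natDegree`).

For (W2), replacing "zero" by "order p" at one linear g multiplies the probability by p^{-2}(1 -
p^{-n}) (`uniformProb_card_cokernel`). This comes from counting the nonzero functionals φ on
(ℤ[x]/𝔪²)^n with values in 𝔽_p: the columns must generate ker φ, which needs exactly n+1 generators
because 𝔪/𝔪² has order p².

The p choices of a mod p and (W1) are disjoint, so the probability is exactly (1 + p^{-1}(1 -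
p^{-n})) ∏_{i=1}^{n} (1 - p^{-i}) for each n, and the limit follows. -/

/-! ### Cokernels under base change -/

namespace Matrix.Cokernel

section BaseChange

variable {A : Type*} (L : Type*) [CommRing A] [CommRing L] [Algebra A L] {m n : Type*}
  [Fintype n]

/-- The map from the base change of a cokernel to the cokernel of the base change. -/
noncomputable def toBaseChange (T : Matrix m n A) :
    T.Cokernel ⊗[A] L →ₗ[A] (T.map (algebraMap A L)).Cokernel :=
  TensorProduct.lift <| Submodule.liftQ _
    (LinearMap.mk₂ A (fun (v : m → A) (l : L) =>
        (Submodule.Quotient.mk (fun i => algebraMap A L (v i) * l) :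
          (T.map (algebraMap A L)).Cokernel))
      (fun v w l => by
        rw [← Submodule.Quotient.mk_add]; congr 1; ext i; simp [add_mul])
      (fun a v l => by
        rw [← Submodule.Quotient.mk_smul]; congr 1; ext i; simp [Algebra.smul_def, mul_assoc])
      (fun v l l' => by
        rw [← Submodule.Quotient.mk_add]; congr 1; ext i; simp [mul_add])
      (fun a v l => by
        rw [← Submodule.Quotient.mk_smul]; congr 1; ext i; simp [Algebra.smul_def]; ring)) <| by
    rintro _ ⟨w, rfl⟩
    rw [LinearMap.mem_ker]
    ext l
    rw [LinearMap.mk₂_apply, LinearMap.zero_apply, Submodule.Quotient.mk_eq_zero]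
    refine ⟨fun j => algebraMap A L (w j) * l, ?_⟩
    ext i
    simp [Matrix.mulVec, dotProduct, Finset.sum_mul, mul_assoc]

theorem toBaseChange_mk_tmul (T : Matrix m n A) (v : m → A) (l : L) :
    toBaseChange L T ((Submodule.Quotient.mk v : T.Cokernel) ⊗ₜ[A] l) =
      Submodule.Quotient.mk (fun i => algebraMap A L (v i) * l) := rfl

variable [Fintype m] [DecidableEq m]

/-- The inverse of `toBaseChange`. -/
noncomputable def ofBaseChange (T : Matrix m n A) :
    (T.map (algebraMap A L)).Cokernel →ₗ[A] T.Cokernel ⊗[A] L :=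
  (Submodule.liftQ ((LinearMap.range (T.map (algebraMap A L)).mulVecLin).restrictScalars A)
    (∑ i, (TensorProduct.mk A T.Cokernel L (Submodule.Quotient.mk (Pi.single i 1))) ∘ₗ
      (LinearMap.proj i : (m → L) →ₗ[A] L)) <| by
    rintro _ ⟨w, rfl⟩
    -- The `j`-th column of `T` is the image of the `j`-th basis vector, so it dies in the cokernel.
    have key (j : n) : ∑ i, T i j • (Submodule.Quotient.mk (Pi.single i 1) : T.Cokernel) = 0 := by
      simp_rw [← Submodule.Quotient.mk_smul, ← Submodule.mkQ_apply]
      rw [← map_sum, Submodule.mkQ_apply, Submodule.Quotient.mk_eq_zero]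
      classical
      refine ⟨Pi.single j 1, ?_⟩
      ext k
      simp [Finset.sum_apply, Pi.single_apply]
    have : ∀ i, (TensorProduct.mk A T.Cokernel L (Submodule.Quotient.mk (Pi.single i 1)))
        ((T.map (algebraMap A L)).mulVecLin w i) =
        ∑ j, (T i j • (Submodule.Quotient.mk (Pi.single i 1) : T.Cokernel)) ⊗ₜ[A] w j := by
      intro i
      simp [Matrix.mulVec, dotProduct, TensorProduct.smul_tmul,
        Algebra.smul_def]
    rw [LinearMap.mem_ker]
    simp only [LinearMap.sum_apply, LinearMap.comp_apply, LinearMap.proj_apply]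
    simp_rw [this]
    rw [Finset.sum_comm]
    simp_rw [← TensorProduct.sum_tmul, key, TensorProduct.zero_tmul, Finset.sum_const_zero]) ∘ₗ
  (Submodule.Quotient.restrictScalarsEquiv A _).symm.toLinearMap

theorem ofBaseChange_mk (T : Matrix m n A) (z : m → L) :
    ofBaseChange L T (Submodule.Quotient.mk z) =
      ∑ i, (Submodule.Quotient.mk (Pi.single i 1) : T.Cokernel) ⊗ₜ[A] z i := by
  change (∑ i, (TensorProduct.mk A T.Cokernel L (Submodule.Quotient.mk (Pi.single i 1))) ∘ₗ
      (LinearMap.proj i : (m → L) →ₗ[A] L)) z = _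
  simp

/-- The base change of a cokernel is the cokernel of the base change. -/
noncomputable def baseChangeEquiv (T : Matrix m n A) :
    T.Cokernel ⊗[A] L ≃ₗ[A] (T.map (algebraMap A L)).Cokernel :=
  LinearEquiv.ofLinearMap (toBaseChange L T) (ofBaseChange L T)
    (by
      apply LinearMap.ext
      intro x
      obtain ⟨z, rfl⟩ := Submodule.Quotient.mk_surjective _ x
      rw [LinearMap.comp_apply, ofBaseChange_mk, map_sum]
      simp_rw [toBaseChange_mk_tmul]
      simp_rw [← Submodule.mkQ_apply]
      rw [← map_sum, LinearMap.id_apply]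
      congr 1
      ext k
      simp [Finset.sum_apply, Pi.single_apply])
    (by
      refine TensorProduct.ext' fun x l => ?_
      obtain ⟨v, rfl⟩ := Submodule.Quotient.mk_surjective _ x
      rw [LinearMap.comp_apply, toBaseChange_mk_tmul, ofBaseChange_mk, LinearMap.id_apply]
      simp_rw [← Algebra.smul_def, ← TensorProduct.smul_tmul, ← Submodule.Quotient.mk_smul]
      rw [← TensorProduct.sum_tmul]
      congr 1
      simp_rw [← Submodule.mkQ_apply]
      rw [← map_sum]
      congr 1
      ext k
      simp [Finset.sum_apply, Pi.single_apply])

end BaseChange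

/-! ### Cokernels under reduction along a surjective ring map. -/

section Reduction

variable {A S : Type*} [CommRing A] [CommRing S] {m n : Type*} [Fintype n]

theorem subsingleton_iff (T : Matrix m n A) :
    Subsingleton T.Cokernel ↔ Function.Surjective T.mulVec := by
  rw [Submodule.Quotient.subsingleton_iff, LinearMap.range_eq_top]
  rfl

theorem comp_mem_range_iff {f : A →+* S} (hf : Function.Surjective f) (T : Matrix m n A)
    (v : m → A) : f ∘ v ∈ LinearMap.range (T.map f).mulVecLin ↔
      ∃ w, ∀ i, v i - T.mulVec w i ∈ RingHom.ker f := by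
  constructor
  · rintro ⟨w, hw⟩
    choose g hg using hf
    refine ⟨g ∘ w, fun i => ?_⟩
    have h := congr_fun hw i
    rw [Matrix.mulVecLin_apply] at h
    rw [RingHom.mem_ker, map_sub, RingHom.map_mulVec, sub_eq_zero]
    rw [← Function.comp_assoc]
    simp only [Function.comp_def, hg] at h ⊢
    exact h.symm
  · rintro ⟨w, hw⟩
    refine ⟨f ∘ w, ?_⟩
    ext i
    have h := hw i
    rw [RingHom.mem_ker, map_sub, RingHom.map_mulVec, sub_eq_zero] at h
    exact h.symm

theorem mem_smul_top_iff [Fintype m] (J : Ideal A) (v : m → A) :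
    v ∈ J • (⊤ : Submodule A (m → A)) ↔ ∀ i, v i ∈ J := by
  classical
  constructor
  · intro h i
    refine Submodule.smul_induction_on (p := fun v => v i ∈ J) h (fun r hr x _ => ?_) (fun x y hx hy => ?_)
    · exact J.mul_mem_right _ hr
    · exact J.add_mem hx hy
  · intro h
    rw [show v = ∑ i, v i • (Pi.single i (1 : A) : m → A) by
      ext k; simp [Finset.sum_apply, Pi.single_apply]]
    exact Submodule.sum_mem _ fun i _ => Submodule.smul_mem_smul (h i) trivial

/-- Nakayama: surjectivity over the quotient says that the range of `T` together with `ker f` times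
the free module is everything. -/
theorem surjective_map_iff [Fintype m] {f : A →+* S} (hf : Function.Surjective f)
    (hker : RingHom.ker f ≤ (⊥ : Ideal A).jacobson) (T : Matrix m n A) :
    Function.Surjective (T.map f).mulVec ↔ Function.Surjective T.mulVec := by
  constructor
  · intro h
    suffices hr : (⊤ : Submodule A (m → A)) ≤ LinearMap.range T.mulVecLin by
      intro v
      exact hr (x := v) trivial
    refine Submodule.le_of_le_smul_of_le_jacobson_bot Module.Finite.fg_top hker fun v _ => ?_
    obtain ⟨w, hw⟩ := (comp_mem_range_iff hf T v).mp (h (f ∘ v))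
    refine Submodule.mem_sup.mpr ⟨_, ⟨w, rfl⟩, v - T.mulVec w, ?_, ?_⟩
    · exact (mem_smul_top_iff _ _).mpr hw
    · simp
  · intro h v
    choose g hg using hf
    obtain ⟨w, hw⟩ := h (g ∘ v)
    refine ⟨f ∘ w, ?_⟩
    ext i
    rw [← RingHom.map_mulVec, hw]
    exact hg _

/-- The reduction map between cokernels. -/
noncomputable def reduce (f : A →+* S) (T : Matrix m n A) :
    T.Cokernel →+ (T.map f).Cokernel :=
  QuotientAddGroup.map _ (LinearMap.range (T.map f).mulVecLin).toAddSubgroup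
    (AddMonoidHom.pi fun i => f.toAddMonoidHom.comp (Pi.evalAddMonoidHom _ i)) <| by
    rintro _ ⟨w, rfl⟩
    refine ⟨f ∘ w, ?_⟩
    ext i
    exact (RingHom.map_mulVec f T w i).symm

theorem reduce_mk (f : A →+* S) (T : Matrix m n A) (v : m → A) :
    reduce f T (Submodule.Quotient.mk v) = Submodule.Quotient.mk (f ∘ v) := rfl

theorem reduce_surjective {f : A →+* S} (hf : Function.Surjective f) (T : Matrix m n A) :
    Function.Surjective (reduce f T) := by
  intro x
  obtain ⟨v, rfl⟩ := Submodule.Quotient.mk_surjective _ x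
  choose g hg using hf
  refine ⟨Submodule.Quotient.mk (g ∘ v), ?_⟩
  rw [reduce_mk]
  congr 1
  ext i
  exact hg _

end Reduction

end Matrix.Cokernel

/-! ### Modules of prime cardinality -/

section PrimeCard

variable {A N : Type*} [CommRing A] [AddCommGroup N] [Module A N] {p : ℕ} [Fact p.Prime]

theorem Submodule.eq_bot_or_eq_top_of_card_prime (hN : Nat.card N = p) (K : Submodule A N) :
    K = ⊥ ∨ K = ⊤ := by
  have : Fact (Nat.card N).Prime := ⟨hN ▸ Fact.out⟩
  refine (AddSubgroup.eq_bot_or_eq_top_of_prime_card K.toAddSubgroup).imp (fun h => ?_)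
    fun h => ?_
  · exact Submodule.toAddSubgroup_injective h
  · exact Submodule.toAddSubgroup_injective h

/-- A module of prime order has no proper nonzero submodule, and Nakayama forbids `J • N = N` for
nonzero `N`. -/
theorem Ideal.smul_top_eq_bot_of_card_prime (hN : Nat.card N = p) {J : Ideal A}
    (hJ : J ≤ (⊥ : Ideal A).jacobson) : J • (⊤ : Submodule A N) = ⊥ := by
  have hp : p.Prime := Fact.out
  have : Finite N := Nat.finite_of_card_ne_zero (hN ▸ hp.ne_zero)
  refine (Submodule.eq_bot_or_eq_top_of_card_prime hN _).resolve_right fun h => ?_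
  have htop := Submodule.eq_bot_of_le_smul_of_le_jacobson_bot J (⊤ : Submodule A N)
    Module.Finite.fg_top h.ge hJ
  have : Subsingleton N := (Submodule.subsingleton_iff A).mp
    (subsingleton_iff_bot_eq_top.mp htop.symm)
  exact hp.one_lt.ne' (hN ▸ Nat.card_of_subsingleton (0 : N))

/-- Any nonzero `z` generates `N`, so `a ↦ a • z` is a surjection between sets of the same size `p`.
-/
theorem Ideal.nonempty_quotient_equiv_of_card_prime (hN : Nat.card N = p) {I : Ideal A}
    (hI : Nat.card (A ⧸ I) = p) (h : ∀ a ∈ I, ∀ x : N, a • x = 0) :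
    Nonempty ((A ⧸ I) ≃ₗ[A] N) := by
  have hp : p.Prime := Fact.out
  have : Finite N := Nat.finite_of_card_ne_zero (hN ▸ hp.ne_zero)
  have : Nontrivial N := Finite.one_lt_card_iff_nontrivial.mp (hN ▸ hp.one_lt)
  obtain ⟨z, hz⟩ := exists_ne (0 : N)
  let f : (A ⧸ I) →ₗ[A] N := I.liftQ (LinearMap.toSpanSingleton A N z) fun a ha => h a ha z
  have hf : LinearMap.range f = ⊤ := by
    refine (Submodule.eq_bot_or_eq_top_of_card_prime hN _).resolve_left fun h0 => hz ?_
    have : f (Submodule.Quotient.mk 1) ∈ LinearMap.range f := ⟨_, rfl⟩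
    rw [h0, Submodule.mem_bot] at this
    exact (one_smul A z).symm.trans this
  have : Finite (A ⧸ I) := Nat.finite_of_card_ne_zero (hI ▸ hp.ne_zero)
  exact ⟨LinearEquiv.ofBijective f ((Nat.bijective_iff_surjective_and_card f).mpr
    ⟨LinearMap.range_eq_top.mp hf, hI.trans hN.symm⟩)⟩

end PrimeCard

/-- Passing to the quotient by `J ^ 2` loses nothing here. If the reduced cokernel has order `p`, it
is killed by the image of `J`, so `J L^m` lies in the range plus `J · (J L^m)`. Nakayama for the
finitely generated module `J L^m` then puts it inside the range. The cokernel over `L` is therefore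
killed by `J` and agrees with its reduction. Modulo `J` alone this argument would not start. -/
theorem Matrix.Cokernel.nonempty_equiv_iff {A L S Q : Type*} [CommRing A] [CommRing L]
    [CommRing S] [Algebra A L] {m n : Type*} [Fintype m] [Fintype n] {p : ℕ} [Fact p.Prime]
    [AddCommGroup Q] [Module A Q] (B : Matrix m n L) {I : Ideal A} {J : Ideal L}
    (hJ : J ≤ (⊥ : Ideal L).jacobson) (hJfg : J.FG) {f : L →+* S} (hf : Function.Surjective f)
    (hker : RingHom.ker f = J ^ 2) (hI : ∀ a ∈ I, algebraMap A L a ∈ J)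
    (e : (A ⧸ I) ≃ₗ[A] Q) (hQ : Nat.card Q = p) :
    Nonempty (B.Cokernel ≃ₗ[A] Q) ↔ Nat.card (B.map f).Cokernel = p := by
  have hp : p.Prime := Fact.out
  have hker' : RingHom.ker f ≤ (⊥ : Ideal L).jacobson :=
    (hker.trans_le (Ideal.pow_le_self two_ne_zero)).trans hJ
  constructor
  · rintro ⟨e'⟩
    have hB : Nat.card B.Cokernel = p := (Nat.card_congr e'.toEquiv).trans hQ
    have : Finite B.Cokernel := Nat.finite_of_card_ne_zero (hB ▸ hp.ne_zero)
    have hs := reduce_surjective hf B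
    have hdvd : Nat.card (B.map f).Cokernel ∣ p :=
      hB ▸ AddSubgroup.card_dvd_of_surjective _ hs
    refine ((Nat.dvd_prime hp).mp hdvd).resolve_left fun h1 => ?_
    have := (Nat.card_eq_one_iff_unique.mp h1).1
    rw [subsingleton_iff, surjective_map_iff hf hker', ← subsingleton_iff] at this
    exact hp.one_lt.ne' (hB ▸ Nat.card_of_subsingleton (0 : B.Cokernel))
  · intro hcard
    -- Elements of `J` square to zero under `f`, so their images are nilpotent.
    have hJf : J.map f ≤ (⊥ : Ideal S).jacobson := by
      refine (Ideal.map_le_iff_le_comap).mpr fun x hx => ?_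
      have hx2 : f x ^ 2 = 0 := by
        rw [← map_pow, ← RingHom.mem_ker, hker]
        exact Ideal.pow_mem_pow hx 2
      exact Ideal.radical_le_jacobson ⟨2, by simp [hx2]⟩
    have h0 := Ideal.smul_top_eq_bot_of_card_prime hcard hJf
    have hle : J • (⊤ : Submodule L (m → L)) ≤ LinearMap.range B.mulVecLin := by
      refine Submodule.le_of_le_smul_of_le_jacobson_bot (Submodule.FG.smul hJfg Module.Finite.fg_top) hJ ?_
      refine Submodule.smul_le.mpr fun r hr v _ => ?_
      have h1 : f r • (Submodule.Quotient.mk (f ∘ v) : (B.map f).Cokernel) = 0 := by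
        rw [← Submodule.mem_bot S, ← h0]
        exact Submodule.smul_mem_smul (Ideal.mem_map_of_mem f hr) trivial
      rw [← Submodule.Quotient.mk_smul, Submodule.Quotient.mk_eq_zero,
        show f r • (f ∘ v) = f ∘ (r • v) by ext; simp, comp_mem_range_iff hf] at h1
      obtain ⟨w, hw⟩ := h1
      refine Submodule.mem_sup.mpr ⟨_, ⟨w, rfl⟩, r • v - B.mulVec w, ?_, by simp⟩
      rw [← Submodule.smul_assoc, smul_eq_mul, ← pow_two, mem_smul_top_iff, ← hker]
      exact hw
    have hB : Nat.card B.Cokernel = p := by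
      rw [← hcard]
      refine Nat.card_congr (Equiv.ofBijective (reduce f B) ⟨?_, reduce_surjective hf B⟩)
      refine (injective_iff_map_eq_zero _).mpr fun x hx => ?_
      obtain ⟨v, rfl⟩ := Submodule.Quotient.mk_surjective _ x
      rw [reduce_mk, Submodule.Quotient.mk_eq_zero, comp_mem_range_iff hf] at hx
      obtain ⟨w, hw⟩ := hx
      rw [Submodule.Quotient.mk_eq_zero]
      have h2 : v - B.mulVec w ∈ LinearMap.range B.mulVecLin := hle <|
        (mem_smul_top_iff _ _).mpr fun i => Ideal.pow_le_self two_ne_zero (hker ▸ hw i)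
      have := add_mem h2 (⟨w, rfl⟩ : B.mulVec w ∈ LinearMap.range B.mulVecLin)
      simpa using this
    obtain ⟨e'⟩ := Ideal.nonempty_quotient_equiv_of_card_prime hB
      ((Nat.card_congr e.toEquiv).trans hQ) fun a ha x => by
        obtain ⟨v, rfl⟩ := Submodule.Quotient.mk_surjective _ x
        rw [← algebraMap_smul L a, ← Submodule.Quotient.mk_smul, Submodule.Quotient.mk_eq_zero]
        exact hle (Submodule.smul_mem_smul (hI a ha) trivial)
    exact ⟨e'.symm.trans e⟩

/-! ### Reduction to finite quotients -/

namespace ProfiniteCompletion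

variable {R : Type*} [CommRing R]

theorem proj_surjective (I : FiniteIndexIdeal R) : Function.Surjective (proj I) := fun x => by
  obtain ⟨r, rfl⟩ := Ideal.Quotient.mk_surjective x
  exact ⟨of r, rfl⟩

theorem evalₐ_toAdicCompletion [IsNoetherianRing R] (I : Ideal R) [Finite (R ⧸ I)] (k : ℕ) (r : ProfiniteCompletion R) :
    AdicCompletion.evalₐ I k (toAdicCompletion I r) = proj (powIdeal I k) r := by
  rw [toAdicCompletion, AdicCompletion.evalₐ_liftRingHom]
  exact fun {j k} hle => RingHom.ext fun r =>
    factor_proj (powIdeal I k) (powIdeal I j) (Ideal.pow_le_pow_right hle) r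

end ProfiniteCompletion

namespace AdicCompletion

variable {R : Type*} [CommRing R] (I : Ideal R)

theorem ker_evalₐ (hI : I.FG) (k : ℕ) : RingHom.ker (evalₐ I k).toRingHom =
    I.map (algebraMap R (AdicCompletion I R)) ^ k := by
  rw [← Ideal.map_pow]
  ext x
  have h1 : x ∈ RingHom.ker (evalₐ I k).toRingHom ↔
      x ∈ (eval I R k).ker := by
    rw [RingHom.mem_ker, LinearMap.mem_ker, eval_apply]
    have h : (I ^ k • ⊤ : Ideal R) = I ^ k := by simp
    exact (Ideal.quotientEquivAlgOfEq R h).map_eq_zero_iff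
  rw [h1, ← pow_smul_top_eq_ker_eval hI, Ideal.smul_top_eq_map]
  rfl

theorem map_le_jacobson (hI : I.FG) : I.map (algebraMap R (AdicCompletion I R)) ≤
    (⊥ : Ideal (AdicCompletion I R)).jacobson :=
  have := isAdicComplete_self I hI
  IsAdicComplete.le_jacobson_bot _

end AdicCompletion

namespace IrredModPoly

variable {p : ℕ} [Fact p.Prime] (β : IrredModPoly p)

/-- Pulling back the image of `(β)` under reduction adds the kernel `(p)`. In particular the ideal
depends on `β` only through its reduction. -/
theorem ideal_eq_comap : β.ideal =
    (Ideal.span {β.reduction}).comap (mapRingHom (Int.castRingHom (ZMod p))) := by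
  have hs : Function.Surjective (mapRingHom (Int.castRingHom (ZMod p))) :=
    map_surjective _ (ZMod.ringHom_surjective _)
  have h1 : Ideal.span {β.reduction} =
      (Ideal.span {β.poly}).map (mapRingHom (Int.castRingHom (ZMod p))) := by
    rw [Ideal.map_span, Set.image_singleton]
    rfl
  have h2 : RingHom.ker (mapRingHom (Int.castRingHom (ZMod p))) =
      Ideal.span {C (p : ℤ)} := by
    rw [ker_mapRingHom, ZMod.ker_intCastRingHom, Ideal.map_span, Set.image_singleton]
  rw [h1, Ideal.comap_map_of_surjective' _ hs, h2, ideal, Ideal.span_insert, sup_comm]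

theorem toResidue_bijective : Function.Bijective β.toResidue := by
  constructor
  · refine (injective_iff_map_eq_zero _).mpr fun x hx => ?_
    obtain ⟨f, rfl⟩ := Ideal.Quotient.mk_surjective x
    rw [Ideal.Quotient.eq_zero_iff_mem, ideal_eq_comap, Ideal.mem_comap]
    exact Ideal.Quotient.eq_zero_iff_mem.mp hx
  · exact Ideal.Quotient.lift_surjective_of_surjective _ _
      (Ideal.Quotient.mk_surjective.comp (map_surjective _ (ZMod.ringHom_surjective _)))

theorem card_residue : Nat.card β.Residue = p ^ β.reduction.natDegree := by
  have hm : β.reduction.Monic := β.monic.map _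
  refine (Nat.card_congr (AdjoinRoot.powerBasis' hm).basis.equivFun.toEquiv).trans ?_
  simp

theorem natDegree_reduction_linear (a : ℤ) : (linear p a).reduction.natDegree = 1 := by
  rw [reduction, linear, Polynomial.map_sub, map_X, map_C, natDegree_X_sub_C]

theorem subsingleton_tensor_iff {m n : Type*} [Fintype m] [Fintype n]
    (T : Matrix m n (ProfiniteCompletion ℤ[X])) :
    Subsingleton (T.Cokernel ⊗[ProfiniteCompletion ℤ[X]] β.LocalRing) ↔
      Function.Surjective
        (T.map (ProfiniteCompletion.proj (ProfiniteCompletion.powIdeal β.ideal 2))).mulVec := by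
  classical
  have hfg : β.ideal.FG := IsNoetherian.noetherian _
  rw [(Matrix.Cokernel.baseChangeEquiv β.LocalRing T).toEquiv.subsingleton_congr,
    Matrix.Cokernel.subsingleton_iff,
    ← Matrix.Cokernel.surjective_map_iff
      (f := (AdicCompletion.evalₐ β.ideal 2).toRingHom)
      (AdicCompletion.surjective_evalₐ β.ideal 2), Matrix.map_map]
  · rw [show ⇑(AdicCompletion.evalₐ β.ideal 2).toRingHom ∘
        ⇑(algebraMap (ProfiniteCompletion ℤ[X]) β.LocalRing) =
        ProfiniteCompletion.proj (ProfiniteCompletion.powIdeal β.ideal 2) from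
      funext (ProfiniteCompletion.evalₐ_toAdicCompletion _ _)]
  · rw [AdicCompletion.ker_evalₐ _ hfg]
    exact (Ideal.pow_le_self two_ne_zero).trans (AdicCompletion.map_le_jacobson _ hfg)

theorem nonempty_tensor_equiv_iff {m n : Type*} [Fintype m] [Fintype n]
    (T : Matrix m n (ProfiniteCompletion ℤ[X])) (hβ : Nat.card β.Residue = p) :
    Nonempty ((T.Cokernel ⊗[ProfiniteCompletion ℤ[X]] β.LocalRing)
      ≃ₗ[ProfiniteCompletion ℤ[X]] β.Residue) ↔
      Nat.card
        (T.map (ProfiniteCompletion.proj (ProfiniteCompletion.powIdeal β.ideal 2))).Cokernel =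
        p := by
  classical
  have hfg : β.ideal.FG := IsNoetherian.noetherian _
  have hker := AdicCompletion.ker_evalₐ β.ideal hfg
  have hs : Function.Surjective
      (algebraMap (ProfiniteCompletion ℤ[X]) β.Residue) :=
    β.toResidue_bijective.2.comp (ProfiniteCompletion.proj_surjective _)
  have hc : Nonempty ((T.Cokernel ⊗[ProfiniteCompletion ℤ[X]] β.LocalRing)
      ≃ₗ[ProfiniteCompletion ℤ[X]] β.Residue) ↔
      Nonempty ((T.map (algebraMap (ProfiniteCompletion ℤ[X]) β.LocalRing)).Cokernel
        ≃ₗ[ProfiniteCompletion ℤ[X]] β.Residue) :=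
    ⟨fun ⟨e⟩ => ⟨(Matrix.Cokernel.baseChangeEquiv β.LocalRing T).symm.trans e⟩,
      fun ⟨e⟩ => ⟨(Matrix.Cokernel.baseChangeEquiv β.LocalRing T).trans e⟩⟩
  rw [hc, Matrix.Cokernel.nonempty_equiv_iff
    (I := RingHom.ker (algebraMap (ProfiniteCompletion ℤ[X]) β.Residue)) _
    (AdicCompletion.map_le_jacobson _ hfg) (Ideal.FG.map hfg _)
    (f := (AdicCompletion.evalₐ β.ideal 2).toRingHom)
    (AdicCompletion.surjective_evalₐ β.ideal 2) (hker 2) ?_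
    (LinearMap.quotKerEquivOfSurjective
      (Algebra.linearMap (ProfiniteCompletion ℤ[X]) β.Residue) hs) hβ, Matrix.map_map]
  · rw [show ⇑(AdicCompletion.evalₐ β.ideal 2).toRingHom ∘
        ⇑(algebraMap (ProfiniteCompletion ℤ[X]) β.LocalRing) =
        ProfiniteCompletion.proj (ProfiniteCompletion.powIdeal β.ideal 2) from
      funext (ProfiniteCompletion.evalₐ_toAdicCompletion _ _)]
  -- An element acting as zero on the residue field vanishes at level 1 of the completion, whose
  -- kernel is the extended maximal ideal.
  · intro a ha
    rw [← pow_one (Ideal.map _ _), ← hker 1, RingHom.mem_ker]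
    have h0 : ProfiniteCompletion.proj ⟨β.ideal, inferInstance⟩ a = 0 :=
      (map_eq_zero_iff _ β.toResidue_bijective.1).mp ha
    have h1 : ProfiniteCompletion.proj (ProfiniteCompletion.powIdeal β.ideal 1) a = 0 := by
      rw [← ProfiniteCompletion.factor_proj ⟨β.ideal, inferInstance⟩
        (ProfiniteCompletion.powIdeal β.ideal 1) (pow_one β.ideal).ge, h0, map_zero]
    exact (ProfiniteCompletion.evalₐ_toAdicCompletion _ _ _).trans h1

end IrredModPoly

/-! ### The uniform distribution on a finite type -/

/-- The probability of a set under the uniform distribution on a finite type. -/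
noncomputable def uniformProb {G : Type*} (B : Set G) : ℝ := Nat.card B / Nat.card G

section UniformProb

variable {G H : Type*}

theorem uniformProb_preimage_equiv (e : G ≃ H) (B : Set H) :
    uniformProb (e ⁻¹' B) = uniformProb B := by
  have h : Nat.card (e ⁻¹' B) = Nat.card B := Nat.card_congr (e.subtypeEquiv fun _ => Iff.rfl)
  rw [uniformProb, uniformProb, Nat.card_congr e, h]

theorem card_preimage_of_surjective [AddGroup G] [AddGroup H] [Finite G] (f : G →+ H)
    (hf : Function.Surjective f) (B : Set H) :
    Nat.card (f ⁻¹' B) = Nat.card B * Nat.card f.ker := by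
  choose g hg using hf
  rw [← Nat.card_prod]
  refine Nat.card_congr
    { toFun x := (⟨f x.1, x.2⟩, ⟨x.1 - g (f x.1), by simp [AddMonoidHom.mem_ker, hg]⟩)
      invFun y := ⟨y.2.1 + g y.1.1, by
        have h : f y.2.1 = 0 := y.2.2
        simp [h, hg]⟩
      left_inv x := by simp
      right_inv y := by
        have h : f y.2.1 = 0 := y.2.2
        ext <;> simp [h, hg] }

/-- All fibres of a surjective homomorphism have the size of the kernel. -/
theorem uniformProb_preimage [AddGroup G] [AddGroup H] [Finite G] (f : G →+ H)
    (hf : Function.Surjective f) (B : Set H) : uniformProb (f ⁻¹' B) = uniformProb B := by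
  have h1 := card_preimage_of_surjective f hf Set.univ
  have h2 : (Nat.card f.ker : ℝ) ≠ 0 := by exact_mod_cast Nat.card_pos.ne'
  rw [Set.preimage_univ, Nat.card_univ, Nat.card_univ] at h1
  rw [uniformProb, uniformProb, card_preimage_of_surjective f hf, h1]
  push_cast
  exact mul_div_mul_right _ _ h2

theorem uniformProb_pi {ι : Type*} [Fintype ι] {G : ι → Type*} (B : ∀ i, Set (G i)) :
    uniformProb (Set.univ.pi B) = ∏ i, uniformProb (B i) := by
  simp only [uniformProb]
  rw [Finset.prod_div_distrib, Nat.card_pi, Nat.card_congr (Equiv.Set.univPi B), Nat.card_pi]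
  push_cast
  rfl

end UniformProb

/-! ### Counting over finite fields -/

section FiniteField

variable {K V : Type*} [Field K] [Finite K] [AddCommGroup V] [Module K V] [Finite V]

/-- With `d` the dimension and `q` the size of `K`, the vector of index `i` must avoid a subspace of
size `q ^ i`, which contributes `(q ^ d - q ^ i) / q ^ d`. -/
theorem uniformProb_linearIndependent {k : ℕ} (hk : k ≤ Module.finrank K V) :
    uniformProb {s : Fin k → V | LinearIndependent K s} =
      ∏ i ∈ Finset.range k, (1 - 1 / (Nat.card K : ℝ) ^ (Module.finrank K V - i)) := by
  have := Fintype.ofFinite K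
  have hq : (Nat.card K : ℝ) ≠ 0 := by exact_mod_cast Nat.card_pos.ne'
  have hV : Nat.card V = Nat.card K ^ Module.finrank K V := Module.natCard_eq_pow_finrank
  have hq1 : 1 ≤ Nat.card K := Nat.card_pos
  rw [uniformProb, Set.coe_ofPred, card_linearIndependent hk, Nat.card_fun, hV,
    ← Fin.prod_univ_eq_prod_range (fun i => 1 - 1 / (Nat.card K : ℝ) ^ (Module.finrank K V - i)),
    Nat.card_fin, ← Nat.card_eq_fintype_card, Nat.cast_prod]
  rw [show ((((Nat.card K ^ Module.finrank K V) ^ k : ℕ)) : ℝ) =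
    ∏ _i : Fin k, (Nat.card K : ℝ) ^ Module.finrank K V by simp, ← Finset.prod_div_distrib]
  refine Finset.prod_congr rfl fun i _ => ?_
  have hi : (i : ℕ) ≤ Module.finrank K V := i.2.le.trans hk
  rw [Nat.cast_sub (Nat.pow_le_pow_right hq1 hi)]
  push_cast
  have h1 : (Nat.card K : ℝ) ^ Module.finrank K V =
      (Nat.card K : ℝ) ^ (Module.finrank K V - i) * (Nat.card K : ℝ) ^ (i : ℕ) := by
    rw [← pow_add, Nat.sub_add_cancel hi]
  rw [h1]
  field_simp

omit [Finite K] in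
theorem Matrix.surjective_mulVec_iff_linearIndependent_row {m n : Type*} [Fintype m] [Fintype n]
    (T : Matrix m n K) : Function.Surjective T.mulVec ↔ LinearIndependent K T.row := by
  classical
  constructor
  · intro h
    obtain ⟨B, hB⟩ := Matrix.mulVec_surjective_iff_exists_right_inverse.mp h
    rw [← Matrix.vecMul_injective_iff]
    refine Function.LeftInverse.injective (g := fun w => B.vecMul w) fun v => ?_
    simp [Matrix.vecMul_vecMul, hB]
  · intro h
    have h1 := h.rank_matrix
    have h2 : LinearMap.range T.mulVecLin = ⊤ :=
      Submodule.eq_top_of_finrank_eq (by rw [← Matrix.rank, h1]; simp)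
    exact LinearMap.range_eq_top.mp h2

theorem uniformProb_surjective_mulVec (n : ℕ) {ι : Type*} [Fintype ι]
    (hι : Fintype.card ι = n + 1) :
    uniformProb {T : Matrix (Fin n) ι K | Function.Surjective T.mulVec} =
      ∏ i ∈ Finset.range n, (1 - 1 / (Nat.card K : ℝ) ^ (i + 2)) := by
  have h := uniformProb_linearIndependent (K := K) (V := ι → K) (k := n) (by simp [hι])
  simp_rw [Matrix.surjective_mulVec_iff_linearIndependent_row]
  refine h.trans ?_
  -- The exponents `n + 1 - i` for `i < n` run from `n + 1` down to `2`; reversing the order gives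
  -- `i + 2`.
  rw [← Finset.prod_range_reflect]
  refine Finset.prod_congr rfl fun i hi => ?_
  have := Finset.mem_range.mp hi
  rw [Module.finrank_fintype_fun_eq_card, hι]
  congr 3
  omega

end FiniteField

/-! ### Spanning families of modules over a local ring -/

section Spanning

variable {S : Type*} [CommRing S] {𝔪 : Ideal S} [𝔪.IsMaximal]

/-- By Nakayama, `d` elements generate `N` exactly when their classes form a basis of the
`d`-dimensional space `N ⧸ 𝔪N`. -/
theorem uniformProb_span_eq_top (h𝔪 : 𝔪 ≤ (⊥ : Ideal S).jacobson) [Finite (S ⧸ 𝔪)]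
    {N : Type*} [AddCommGroup N] [Module S N] [Finite N] {d : ℕ}
    (hN : Nat.card (N ⧸ (𝔪 • ⊤ : Submodule S N)) = Nat.card (S ⧸ 𝔪) ^ d) :
    uniformProb {u : Fin d → N | Submodule.span S (Set.range u) = ⊤} =
      ∏ i ∈ Finset.range d, (1 - 1 / (Nat.card (S ⧸ 𝔪) : ℝ) ^ (i + 1)) := by
  let _ := Ideal.Quotient.field 𝔪
  let P := N ⧸ (𝔪 • ⊤ : Submodule S N)
  have hrank : Module.finrank (S ⧸ 𝔪) P = d := by
    have h1 : Nat.card P = Nat.card (S ⧸ 𝔪) ^ Module.finrank (S ⧸ 𝔪) P :=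
      Module.natCard_eq_pow_finrank
    exact (Nat.pow_right_injective (Finite.one_lt_card) (hN.symm.trans h1)).symm
  have key (u : Fin d → N) : Submodule.span S (Set.range u) = ⊤ ↔
      LinearIndependent (S ⧸ 𝔪) (fun i => (Submodule.Quotient.mk (u i) : P)) := by
    have h1 : Submodule.span S (Set.range u) = ⊤ ↔
        Submodule.span (S ⧸ 𝔪) (Set.range fun i => (Submodule.Quotient.mk (u i) : P)) = ⊤ := by
      have h2 := Submodule.restrictScalars_span S (S ⧸ 𝔪) Ideal.Quotient.mk_surjective
        (Set.range fun i => (Submodule.Quotient.mk (u i) : P))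
      have h3 : (Set.range fun i => (Submodule.Quotient.mk (u i) : P)) =
          (𝔪 • ⊤ : Submodule S N).mkQ '' Set.range u := by rw [← Set.range_comp]; rfl
      rw [← Submodule.restrictScalars_eq_top_iff S (S ⧸ 𝔪) P, h2, h3, ← Submodule.map_span,
        Submodule.map_mkQ_eq_top]
      constructor
      · intro h
        rw [h, sup_top_eq]
      · intro h
        exact top_le_iff.mp (Submodule.le_of_le_smul_of_le_jacobson_bot Module.Finite.fg_top h𝔪
          (by rw [sup_comm, h]))
    rw [h1]
    constructor
    · intro h
      exact linearIndependent_of_top_le_span_of_card_eq_finrank h.ge (by rw [Fintype.card_fin]; exact hrank.symm)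
    · intro h
      exact h.span_eq_top_of_card_eq_finrank' (by rw [Fintype.card_fin]; exact hrank.symm)
  have : Finite P := Finite.of_surjective _ (Submodule.mkQ_surjective _)
  have h := uniformProb_linearIndependent (K := S ⧸ 𝔪) (V := P) (k := d) hrank.ge
  rw [← Finset.prod_range_reflect, hrank] at h
  simp_rw [key]
  refine (uniformProb_preimage (AddMonoidHom.pi fun i =>
    (𝔪 • ⊤ : Submodule S N).mkQ.toAddMonoidHom.comp (Pi.evalAddMonoidHom _ i)) ?_
    {s : Fin d → P | LinearIndependent (S ⧸ 𝔪) s}).trans (h.trans ?_)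
  · intro s
    choose g hg using Submodule.Quotient.mk_surjective (𝔪 • ⊤ : Submodule S N)
    exact ⟨g ∘ s, funext fun i => hg _⟩
  · refine Finset.prod_congr rfl fun i hi => ?_
    have := Finset.mem_range.mp hi
    congr 3
    omega

end Spanning

/-! ### Matrices with cokernel of prime order over a local ring with square-zero maximal ideal -/

section SquareZero

variable {S : Type*} [CommRing S] [Finite S] {𝔪 : Ideal S} [𝔪.IsMaximal] {p : ℕ} [Fact p.Prime]

omit [Finite S] in
theorem card_ker_mul_of_surjective {N P : Type*} [AddCommGroup N] [Module S N] [AddCommGroup P]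
    [Module S P] (f : N →ₗ[S] P) (hf : Function.Surjective f) :
    Nat.card (LinearMap.ker f) * Nat.card P = Nat.card N := by
  rw [Submodule.card_eq_card_quotient_mul_card (LinearMap.ker f),
    Nat.card_congr (f.quotKerEquivOfSurjective hf).toEquiv, mul_comm]

variable {n : ℕ}

omit [Finite S] [𝔪.IsMaximal] in
theorem exists_single_ne_zero {φ : (Fin n → S) →ₗ[S] S ⧸ 𝔪} (hφ : φ ≠ 0) :
    ∃ j, φ (Pi.single j 1) ≠ 0 := by
  by_contra! h
  exact hφ (LinearMap.pi_ext' fun i => LinearMap.ext_ring (by simpa using h i))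

omit [Finite S] in
theorem linearMap_quotient_surjective {N : Type*} [AddCommGroup N] [Module S N]
    {φ : N →ₗ[S] S ⧸ 𝔪} (hφ : φ ≠ 0) : Function.Surjective φ := by
  let _ := Ideal.Quotient.field 𝔪
  obtain ⟨x, hx⟩ := DFunLike.ne_iff.mp hφ
  rw [LinearMap.zero_apply] at hx
  intro y
  obtain ⟨s, hs⟩ := Ideal.Quotient.mk_surjective (y * (φ x)⁻¹)
  refine ⟨s • x, ?_⟩
  rw [map_smul, Algebra.smul_def, Ideal.Quotient.algebraMap_eq, hs]
  field_simp

omit [Finite S] in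
-- After a change of basis `ker φ` is `𝔪 ⊕ S^(n-1)`, and multiplying by `𝔪` leaves `𝔪^(n-1)` because
-- `𝔪 ^ 2 = 0`. Without choosing that basis, `𝔪 • ker φ` is identified with the kernel of the
-- surjection `ψ : 𝔪^n → 𝔪` obtained by lifting the coefficients of `φ`.
theorem card_smul_top_ker (h2 : 𝔪 ^ 2 = ⊥) {φ : (Fin n → S) →ₗ[S] S ⧸ 𝔪} (hφ : φ ≠ 0) :
    Nat.card (𝔪 • ⊤ : Submodule S (LinearMap.ker φ)) * Nat.card 𝔪 = Nat.card 𝔪 ^ n := by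
  have hzero {a b : S} (ha : a ∈ 𝔪) (hb : b ∈ 𝔪) : a * b = 0 := by
    rw [← Ideal.mem_bot, ← h2, pow_two]
    exact Ideal.mul_mem_mul ha hb
  have hφsum (v : Fin n → S) : φ v = ∑ i, v i • φ (Pi.single i 1) := by
    rw [LinearMap.pi_apply_eq_sum_univ φ v]
    refine Finset.sum_congr rfl fun i _ => ?_
    congr 2
    ext k
    simp [Pi.single_apply, eq_comm]
  choose c hc using fun i => Ideal.Quotient.mk_surjective (φ (Pi.single i 1))
  have hφc (v : Fin n → S) : φ v = Ideal.Quotient.mk 𝔪 (∑ i, v i * c i) := by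
    rw [hφsum, map_sum]
    refine Finset.sum_congr rfl fun i _ => ?_
    rw [map_mul, hc, Algebra.smul_def, Ideal.Quotient.algebraMap_eq]
  obtain ⟨j, hj⟩ := exists_single_ne_zero hφ
  -- `d` inverts `c j` modulo `𝔪`, hence exactly when acting on `𝔪`, as `𝔪 ^ 2 = 0`.
  obtain ⟨d, hd⟩ : ∃ d, c j * d - 1 ∈ 𝔪 := by
    let _ := Ideal.Quotient.field 𝔪
    obtain ⟨d, hd⟩ := Ideal.Quotient.mk_surjective (φ (Pi.single j 1))⁻¹
    refine ⟨d, ?_⟩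
    rw [← Ideal.Quotient.eq_zero_iff_mem, map_sub, map_mul, hc, hd, map_one, mul_inv_cancel₀ hj,
      sub_self]
  have hcd {a : S} (ha : a ∈ 𝔪) : c j * (d * a) = a := by
    have := hzero hd ha
    linear_combination this
  let ψ : (Fin n → 𝔪) →ₗ[S] 𝔪 := ∑ i, c i • LinearMap.proj i
  have hψ (v : Fin n → 𝔪) : (ψ v : S) = ∑ i, (v i : S) * c i := by
    simp [ψ, LinearMap.sum_apply, mul_comm]
  have hψs : Function.Surjective ψ := fun a => by
    refine ⟨Pi.single j (d • a), Subtype.ext ?_⟩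
    rw [hψ, Finset.sum_eq_single j (fun i _ hi => by simp [hi]) (by simp)]
    simpa [mul_comm] using hcd a.2
  have hmem (v : Fin n → 𝔪) : (fun i => (v i : S)) ∈ LinearMap.ker φ := by
    rw [LinearMap.mem_ker, hφc, Ideal.Quotient.eq_zero_iff_mem]
    exact Ideal.sum_mem _ fun i _ => 𝔪.mul_mem_right _ (v i).2
  let θ : (Fin n → 𝔪) →ₗ[S] LinearMap.ker φ :=
    { toFun v := ⟨fun i => v i, hmem v⟩
      map_add' v w := rfl
      map_smul' a v := rfl }
  have hθ : Function.Injective θ := fun v w h => by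
    ext i
    exact congr_fun (congr_arg Subtype.val h) i
  have himage : (𝔪 • ⊤ : Submodule S (LinearMap.ker φ)) = (LinearMap.ker ψ).map θ := by
    apply le_antisymm
    · refine Submodule.smul_le.mpr fun a ha v _ => ?_
      refine ⟨fun i => ⟨a * v.1 i, 𝔪.mul_mem_right _ ha⟩, ?_, ?_⟩
      · rw [SetLike.mem_coe, LinearMap.mem_ker]
        refine Subtype.ext ?_
        rw [hψ]
        have hv := v.2
        rw [LinearMap.mem_ker, hφc, Ideal.Quotient.eq_zero_iff_mem] at hv
        simpa [Finset.mul_sum, mul_assoc] using hzero ha hv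
      · rfl
    · rintro _ ⟨v, hv, rfl⟩
      have hv0 : ∑ i, (v i : S) * c i = 0 := by
        rw [← hψ, LinearMap.mem_ker.mp hv]
        rfl
      -- The vectors `e_i - d c_i e_j` lie in `ker φ`, and a vector `v` of `ker ψ` is their
      -- combination with coefficients `v i`: the correction along `e_j` is `d ∑ v_i c_i = 0`.
      have hb (i : Fin n) : (Pi.single i 1 - (d * c i) • Pi.single j 1 : Fin n → S) ∈
          LinearMap.ker φ := by
        rw [LinearMap.mem_ker, map_sub, map_smul, Algebra.smul_def, Ideal.Quotient.algebraMap_eq,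
          ← hc, ← hc, ← map_mul, ← map_sub, Ideal.Quotient.eq_zero_iff_mem]
        have := 𝔪.mul_mem_left (-c i) hd
        convert this using 1
        ring
      have : θ v = ∑ i, (v i : S) • (⟨_, hb i⟩ : LinearMap.ker φ) := by
        refine Subtype.ext ?_
        ext k
        have h3 : ∑ i, (v i : S) * (d * c i) = 0 := by
          rw [← mul_zero d, ← hv0, Finset.mul_sum]
          exact Finset.sum_congr rfl fun i _ => by ring
        simp only [θ, LinearMap.coe_mk, AddHom.coe_mk, AddSubmonoidClass.coe_finsetSum,
          SetLike.val_smul, Finset.sum_apply, Pi.smul_apply, Pi.sub_apply, smul_eq_mul, mul_sub,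
          Finset.sum_sub_distrib, ← mul_assoc, ← Finset.sum_mul]
        simp only [mul_assoc] at h3 ⊢
        rw [h3]
        simp [Pi.single_apply]
      rw [this]
      exact Submodule.sum_mem _ fun i _ => Submodule.smul_mem_smul (v i).2 trivial
  have hcard : Nat.card (𝔪 • ⊤ : Submodule S (LinearMap.ker φ)) =
      Nat.card (LinearMap.ker ψ) := by
    rw [himage]
    exact (Nat.card_congr (Submodule.equivMapOfInjective θ hθ _).toEquiv).symm
  rw [hcard, card_ker_mul_of_surjective ψ hψs, Nat.card_fun, Nat.card_fin]

/-- Each of the `n + 1` columns lies in `K = ker φ` with probability `1 / p`. Then `K` has order `p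
^ (3n - 1)` and `𝔪K` has order `p ^ (2n - 2)`, so `K ⧸ 𝔪K` has dimension `n + 1`: the columns must
form a basis of it. -/
theorem uniformProb_range_eq_ker (h2 : 𝔪 ^ 2 = ⊥) (hk : Nat.card (S ⧸ 𝔪) = p)
    (hm : Nat.card 𝔪 = p ^ 2) {φ : (Fin n → S) →ₗ[S] S ⧸ 𝔪} (hφ : φ ≠ 0) :
    uniformProb {T : Matrix (Fin n) (Fin (n + 1)) S |
      LinearMap.range T.mulVecLin = LinearMap.ker φ} =
      1 / (p : ℝ) ^ (n + 1) * ∏ i ∈ Finset.range (n + 1), (1 - 1 / (p : ℝ) ^ (i + 1)) := by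
  have hp : p.Prime := Fact.out
  have hjac : 𝔪 ≤ (⊥ : Ideal S).jacobson := fun x hx =>
    Ideal.radical_le_jacobson ⟨2, h2 ▸ Ideal.pow_mem_pow hx 2⟩
  have hS : Nat.card S = p ^ 3 := by
    rw [Submodule.card_eq_card_quotient_mul_card 𝔪, hk, hm]
    ring
  have hK := card_ker_mul_of_surjective φ (linearMap_quotient_surjective hφ)
  have hmK := card_smul_top_ker h2 hφ
  rw [Nat.card_fun, Nat.card_fin, hk, hS] at hK
  rw [hm] at hmK
  have hQ : Nat.card (LinearMap.ker φ ⧸ (𝔪 • ⊤ : Submodule S (LinearMap.ker φ))) =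
      Nat.card (S ⧸ 𝔪) ^ (n + 1) := by
    have h := Submodule.card_eq_card_quotient_mul_card (𝔪 • ⊤ : Submodule S (LinearMap.ker φ))
    rw [hk]
    -- The factor `p ^ (2n + 1)` clears the subtractions in the exponents, which also covers small
    -- `n`.
    refine Nat.eq_of_mul_eq_mul_right (pow_pos hp.pos (2 * n + 1)) ?_
    calc _ = _ * ((p ^ 2) ^ n) * p := by ring
      _ = (p ^ 3) ^ n * p ^ 2 := by
        rw [← hmK, ← hK, h]; ring
      _ = _ := by ring
  have : Finite (S ⧸ 𝔪) := Finite.of_surjective _ Ideal.Quotient.mk_surjective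
  have hspan := uniformProb_span_eq_top hjac hQ
  rw [hk] at hspan
  rw [← hspan]
  have hcard : Nat.card {T : Matrix (Fin n) (Fin (n + 1)) S |
      LinearMap.range T.mulVecLin = LinearMap.ker φ} =
      Nat.card {u : Fin (n + 1) → LinearMap.ker φ | Submodule.span S (Set.range u) = ⊤} := by
    have key (u : Fin (n + 1) → LinearMap.ker φ) : Submodule.span S (Set.range u) = ⊤ ↔
        LinearMap.range (Matrix.of fun i j => (u j : Fin n → S) i).mulVecLin =
          LinearMap.ker φ := by
      rw [Matrix.range_mulVecLin, ← (Submodule.map_injective_of_injective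
        (LinearMap.ker φ).subtype_injective).eq_iff, Submodule.map_subtype_top,
        Submodule.map_span, ← Set.range_comp]
      rfl
    refine (Nat.card_congr (Equiv.ofBijective (fun u => ⟨_, (key u.1).mp u.2⟩) ⟨?_, ?_⟩)).symm
    · intro u v h
      ext j i
      exact congr_fun (congr_fun (congr_arg Subtype.val h) i) j
    · rintro ⟨T, hT⟩
      have hT' (j : Fin (n + 1)) : T.col j ∈ LinearMap.ker φ := by
        rw [← (show LinearMap.range T.mulVecLin = LinearMap.ker φ from hT),
          Matrix.range_mulVecLin]
        exact Submodule.subset_span ⟨j, rfl⟩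
      exact ⟨⟨fun j => ⟨T.col j, hT' j⟩, (key _).mpr hT⟩, rfl⟩
  have hpR : (p : ℝ) ≠ 0 := by exact_mod_cast hp.ne_zero
  have hKR : (Nat.card (LinearMap.ker φ) : ℝ) * p = ((p : ℝ) ^ 3) ^ n := by exact_mod_cast hK
  have hK0 : (Nat.card (LinearMap.ker φ) : ℝ) ≠ 0 := by exact_mod_cast Nat.card_pos.ne'
  have hMat : (Nat.card (Matrix (Fin n) (Fin (n + 1)) S) : ℝ) =
      ((Nat.card (LinearMap.ker φ) : ℝ) * p) ^ (n + 1) := by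
    rw [hKR]
    simp only [Matrix, Nat.card_fun, Nat.card_fin, hS]
    push_cast
    ring
  rw [uniformProb, uniformProb, hcard, hMat, Nat.card_fun, Nat.card_fin]
  push_cast
  rw [mul_pow]
  field_simp

omit [Finite S] [𝔪.IsMaximal] in
theorem card_linearMap_quotient_quotient : Nat.card ((S ⧸ 𝔪) →ₗ[S] S ⧸ 𝔪) = Nat.card (S ⧸ 𝔪) := by
  refine Nat.card_congr (Equiv.ofBijective (fun f => f 1) ⟨fun f g h => ?_, fun x => ?_⟩)
  · refine Submodule.linearMap_qext _ (LinearMap.ext_ring ?_)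
    exact h
  · obtain ⟨s, rfl⟩ := Ideal.Quotient.mk_surjective x
    refine ⟨s • LinearMap.id, ?_⟩
    simp [Algebra.smul_def]

omit [Finite S] [𝔪.IsMaximal] in
-- Such `φ` correspond to nonzero maps `S^n ⧸ K → S ⧸ 𝔪`, which are automatically injective since
-- the source has prime order. The source is isomorphic to `S ⧸ 𝔪`, so there are `p` maps in all.
theorem card_ne_zero_ker_eq (h2 : 𝔪 ^ 2 = ⊥) (hk : Nat.card (S ⧸ 𝔪) = p)
    (K : Submodule S (Fin n → S)) (hK : Nat.card ((Fin n → S) ⧸ K) = p) :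
    Nat.card {φ : (Fin n → S) →ₗ[S] S ⧸ 𝔪 // φ ≠ 0 ∧ K = LinearMap.ker φ} = p - 1 := by
  have hjac : 𝔪 ≤ (⊥ : Ideal S).jacobson := fun x hx =>
    Ideal.radical_le_jacobson ⟨2, h2 ▸ Ideal.pow_mem_pow hx 2⟩
  have h0 := Ideal.smul_top_eq_bot_of_card_prime hK hjac
  obtain ⟨e⟩ := Ideal.nonempty_quotient_equiv_of_card_prime hK hk fun a ha x => by
    rw [← Submodule.mem_bot S, ← h0]
    exact Submodule.smul_mem_smul ha trivial
  have hHom : Nat.card (((Fin n → S) ⧸ K) →ₗ[S] S ⧸ 𝔪) = p := by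
    rw [← hk, ← card_linearMap_quotient_quotient (𝔪 := 𝔪)]
    exact Nat.card_congr (LinearEquiv.congrLeft (S ⧸ 𝔪) S e).symm.toEquiv
  have hne : Nat.card {ψ : ((Fin n → S) ⧸ K) →ₗ[S] S ⧸ 𝔪 // ψ ≠ 0} = p - 1 := by
    have : Finite (((Fin n → S) ⧸ K) →ₗ[S] S ⧸ 𝔪) :=
      Nat.finite_of_card_ne_zero (hHom ▸ (Fact.out : p.Prime).ne_zero)
    have := Fintype.ofFinite (((Fin n → S) ⧸ K) →ₗ[S] S ⧸ 𝔪)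
    classical
    rw [Nat.card_eq_fintype_card, Fintype.card_subtype, Finset.filter_ne',
      Finset.card_erase_of_mem (Finset.mem_univ _), Finset.card_univ, ← Nat.card_eq_fintype_card,
      hHom]
  rw [← hne]
  have hcomp (ψ : {ψ : ((Fin n → S) ⧸ K) →ₗ[S] S ⧸ 𝔪 // ψ ≠ 0}) :
      ψ.1 ∘ₗ K.mkQ ≠ 0 ∧ K = LinearMap.ker (ψ.1 ∘ₗ K.mkQ) := by
    constructor
    · intro h
      exact ψ.2 (Submodule.linearMap_qext _ (h.trans (LinearMap.zero_comp _).symm))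
    · have : LinearMap.ker ψ.1 = ⊥ :=
        (Submodule.eq_bot_or_eq_top_of_card_prime hK _).resolve_right
          fun h => ψ.2 (LinearMap.ker_eq_top.mp h)
      rw [LinearMap.ker_comp, this, Submodule.comap_bot, Submodule.ker_mkQ]
  refine (Nat.card_congr (Equiv.ofBijective
    (fun ψ => ⟨ψ.1 ∘ₗ K.mkQ, hcomp ψ⟩) ⟨fun ψ ψ' h => ?_, fun φ => ?_⟩)).symm
  · exact Subtype.ext (Submodule.linearMap_qext _ (congr_arg Subtype.val h))
  · refine ⟨⟨K.liftQ φ.1 φ.2.2.le, fun h => φ.2.1 ?_⟩, Subtype.ext (K.liftQ_mkQ _ _)⟩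
    rw [← K.liftQ_mkQ φ.1 φ.2.2.le, h, LinearMap.zero_comp]

open Finset in
-- Double counting of pairs `(T, φ)` with `φ ≠ 0` and range of `T` equal to `ker φ`: a matrix with
-- cokernel of order `p` occurs `p - 1` times, any other matrix never, and there are `p ^ n - 1`
-- functionals.
theorem uniformProb_card_cokernel_fin (h2 : 𝔪 ^ 2 = ⊥) (hk : Nat.card (S ⧸ 𝔪) = p)
    (hm : Nat.card 𝔪 = p ^ 2) :
    uniformProb {T : Matrix (Fin n) (Fin (n + 1)) S | Nat.card T.Cokernel = p} * (p - 1) =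
      (p ^ n - 1) * (1 / (p : ℝ) ^ (n + 1) *
        ∏ i ∈ Finset.range (n + 1), (1 - 1 / (p : ℝ) ^ (i + 1))) := by
  classical
  have hp : p.Prime := Fact.out
  have := Fintype.ofFinite S
  have e : ((Fin n → S) →ₗ[S] S ⧸ 𝔪) ≃ (Fin n → S ⧸ 𝔪) :=
    (LinearEquiv.piRing S (S ⧸ 𝔪) (Fin n) S).toEquiv
  have : Finite ((Fin n → S) →ₗ[S] S ⧸ 𝔪) := Finite.of_equiv _ e.symm
  have := Fintype.ofFinite ((Fin n → S) →ₗ[S] S ⧸ 𝔪)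
  let Φ : Finset ((Fin n → S) →ₗ[S] S ⧸ 𝔪) := univ.filter (· ≠ 0)
  let M : Finset (Matrix (Fin n) (Fin (n + 1)) S) := univ
  let r (T : Matrix (Fin n) (Fin (n + 1)) S) (φ : (Fin n → S) →ₗ[S] S ⧸ 𝔪) : Prop :=
    LinearMap.range T.mulVecLin = LinearMap.ker φ
  have hcount := Finset.sum_card_bipartiteAbove_eq_sum_card_bipartiteBelow r (s := M) (t := Φ)
  have hΦ : (#Φ : ℝ) = p ^ n - 1 := by
    have h1 : #Φ = p ^ n - 1 := by
      simp only [Φ]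
      rw [Finset.filter_ne', Finset.card_erase_of_mem (mem_univ _), Finset.card_univ,
        ← Nat.card_eq_fintype_card, Nat.card_congr e, Nat.card_fun, Nat.card_fin, hk]
    rw [h1, Nat.cast_sub (Nat.one_le_pow _ _ hp.pos)]
    simp
  have hMat : (Nat.card (Matrix (Fin n) (Fin (n + 1)) S) : ℝ) ≠ 0 := by
    exact_mod_cast Nat.card_pos.ne'
  have habove (T : Matrix (Fin n) (Fin (n + 1)) S) :
      #(Φ.bipartiteAbove r T) = if Nat.card T.Cokernel = p then p - 1 else 0 := by
    split_ifs with hT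
    · rw [← card_ne_zero_ker_eq h2 hk (LinearMap.range T.mulVecLin) hT,
        Nat.card_eq_fintype_card, Fintype.card_subtype, Finset.bipartiteAbove,
        Finset.filter_filter]
    · refine Finset.card_eq_zero.mpr (Finset.filter_eq_empty_iff.mpr fun φ hφ hr => hT ?_)
      rw [← hk]
      have hs := linearMap_quotient_surjective (Finset.mem_filter.mp hφ).2
      exact Nat.card_congr ((Submodule.quotEquivOfEq _ _ hr).trans
        (φ.quotKerEquivOfSurjective hs)).toEquiv
  have hbelow (φ : (Fin n → S) →ₗ[S] S ⧸ 𝔪) (hφ : φ ∈ Φ) :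
      (#(M.bipartiteBelow r φ) : ℝ) = 1 / (p : ℝ) ^ (n + 1) *
        (∏ i ∈ Finset.range (n + 1), (1 - 1 / (p : ℝ) ^ (i + 1))) *
        Nat.card (Matrix (Fin n) (Fin (n + 1)) S) := by
    rw [← uniformProb_range_eq_ker h2 hk hm (Finset.mem_filter.mp hφ).2, uniformProb,
      div_mul_cancel₀ _ hMat, Set.coe_ofPred, Nat.card_eq_fintype_card, Fintype.card_subtype]
    rfl
  rw [Finset.sum_congr rfl fun T _ => habove T, ← Finset.sum_filter, Finset.sum_const,
    smul_eq_mul] at hcount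
  have hcount' := congr_arg (Nat.cast : ℕ → ℝ) hcount
  rw [Nat.cast_mul, Nat.cast_sum, Finset.sum_congr rfl hbelow, Finset.sum_const, nsmul_eq_mul,
    hΦ, Nat.cast_sub hp.one_le, Nat.cast_one] at hcount'
  rw [uniformProb, Set.coe_ofPred, Nat.card_eq_fintype_card, Fintype.card_subtype, div_mul_eq_mul_div,
    hcount', div_eq_iff hMat]
  ring

end SquareZero

section SquareZero

variable {S : Type*} [CommRing S] [Finite S] {𝔪 : Ideal S} [𝔪.IsMaximal] {p : ℕ} [Fact p.Prime]

theorem uniformProb_card_cokernel (h2 : 𝔪 ^ 2 = ⊥) (hk : Nat.card (S ⧸ 𝔪) = p)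
    (hm : Nat.card 𝔪 = p ^ 2) (n : ℕ) {ι : Type*} [Fintype ι] (hι : Fintype.card ι = n + 1) :
    uniformProb {T : Matrix (Fin n) ι S | Nat.card T.Cokernel = p} =
      1 / (p : ℝ) ^ 2 * (1 - 1 / (p : ℝ) ^ n) *
        ∏ i ∈ Finset.range n, (1 - 1 / (p : ℝ) ^ (i + 2)) := by
  have hp : p.Prime := Fact.out
  let e : ι ≃ Fin (n + 1) := Fintype.equivFinOfCardEq hι
  have h := uniformProb_card_cokernel_fin (n := n) h2 hk hm
  have he : uniformProb {T : Matrix (Fin n) ι S | Nat.card T.Cokernel = p} =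
      uniformProb {T : Matrix (Fin n) (Fin (n + 1)) S | Nat.card T.Cokernel = p} := by
    rw [← uniformProb_preimage_equiv (Matrix.reindex (Equiv.refl (Fin n)) e)]
    congr 1
    ext T
    have hr : LinearMap.range (T.submatrix (Equiv.refl (Fin n)).symm e.symm).mulVecLin =
        LinearMap.range T.mulVecLin := by
      rw [Matrix.range_mulVecLin, Matrix.range_mulVecLin]
      congr 1
      exact e.symm.surjective.range_comp T.col
    simp only [Set.mem_ofPred_eq, Set.mem_preimage, Matrix.reindex_apply]
    rw [Nat.card_congr (Submodule.quotEquivOfEq _ _ hr).toEquiv]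
  have hp1 : (p : ℝ) - 1 ≠ 0 := sub_ne_zero.mpr (by exact_mod_cast hp.one_lt.ne')
  have hp0 : (p : ℝ) ≠ 0 := by exact_mod_cast hp.ne_zero
  rw [he]
  refine mul_right_cancel₀ hp1 (h.trans ?_)
  -- The split-off factor `1 - 1 / p` cancels `p - 1` and leaves the product for surjectivity.
  rw [Finset.prod_range_succ', zero_add, pow_one, pow_succ]
  field_simp

end SquareZero

/-! ### Local probabilities modulo the square of (p, β). -/

namespace IrredModPoly

variable {p : ℕ} [Fact p.Prime]

theorem card_quotient_ideal (β : IrredModPoly p) :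
    Nat.card (ℤ[X] ⧸ β.ideal) = p ^ β.reduction.natDegree := by
  rw [← card_residue, Nat.card_congr (Equiv.ofBijective _ β.toResidue_bijective)]

instance (β : IrredModPoly p) : β.ideal.IsMaximal := by
  rw [ideal_eq_comap]
  have : (Ideal.span {β.reduction}).IsMaximal :=
    PrincipalIdealRing.isMaximal_of_irreducible β.irreducible
  exact Ideal.comap_isMaximal_of_surjective _ (map_surjective _ (ZMod.ringHom_surjective _))

/-- By Nakayama surjectivity is tested over the residue field of size `p ^ deg β`. Writing the
factor as a power with exponent `deg β` prepares the Euler product for each fixed `i`. -/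
theorem uniformProb_surjective (β : IrredModPoly p) (n : ℕ) :
    uniformProb {T : Matrix (Fin n) (Fin n ⊕ Unit) (ℤ[X] ⧸ β.ideal ^ 2) |
      Function.Surjective T.mulVec} =
      ∏ i ∈ Finset.range n, (1 - (1 / (p : ℝ) ^ (i + 2)) ^ β.reduction.natDegree) := by
  let _ := Ideal.Quotient.field β.ideal
  have : Finite (ℤ[X] ⧸ β.ideal ^ 2) := (ProfiniteCompletion.powIdeal β.ideal 2).2
  have h := uniformProb_surjective_mulVec (K := ℤ[X] ⧸ β.ideal) n (ι := Fin n ⊕ Unit) (by simp)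
  let f := Ideal.Quotient.factor (Ideal.pow_le_self two_ne_zero : β.ideal ^ 2 ≤ β.ideal)
  have hf : Function.Surjective f := Ideal.Quotient.factor_surjective _
  have hker : RingHom.ker f ≤ (⊥ : Ideal (ℤ[X] ⧸ β.ideal ^ 2)).jacobson := by
    intro x hx
    obtain ⟨y, rfl⟩ := Ideal.Quotient.mk_surjective x
    have hy : y ∈ β.ideal := Ideal.Quotient.eq_zero_iff_mem.mp hx
    refine Ideal.radical_le_jacobson ⟨2, ?_⟩
    rw [← map_pow, Ideal.mem_bot, Ideal.Quotient.eq_zero_iff_mem]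
    exact Ideal.pow_mem_pow hy 2
  simp_rw [← Matrix.Cokernel.surjective_map_iff hf hker]
  refine (uniformProb_preimage f.toAddMonoidHom.mapMatrix ?_
    {T : Matrix (Fin n) (Fin n ⊕ Unit) (ℤ[X] ⧸ β.ideal) | Function.Surjective T.mulVec}).trans
    (h.trans ?_)
  · intro T
    choose g hg using hf
    exact ⟨T.map g, Matrix.ext fun i j => hg _⟩
  · rw [card_quotient_ideal]
    refine Finset.prod_congr rfl fun i _ => ?_
    push_cast
    rw [one_div_pow, ← pow_mul, ← pow_mul, mul_comm]

theorem mem_ideal_linear (a : ℤ) (f : ℤ[X]) :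
    f ∈ (linear p a).ideal ↔ (p : ℤ) ∣ f.eval a := by
  rw [ideal_eq_comap, Ideal.mem_comap, Ideal.mem_span_singleton, reduction, linear,
    Polynomial.map_sub, map_X, map_C, dvd_iff_isRoot, IsRoot.def, coe_mapRingHom, eval_map,
    eval₂_at_apply, eq_intCast, ZMod.intCast_zmod_eq_zero_iff_dvd]

/-- Taylor expansion: write `f = f(a) + (X - a) g` with `g(a) = f'(a)`. -/
theorem mem_ideal_linear_sq (a : ℤ) (f : ℤ[X]) :
    f ∈ (linear p a).ideal ^ 2 ↔ (p : ℤ) ^ 2 ∣ f.eval a ∧ (p : ℤ) ∣ f.derivative.eval a := by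
  constructor
  · intro h
    rw [pow_two] at h
    refine Submodule.mul_induction_on h (fun u hu v hv => ?_) (fun u v hu hv => ?_)
    · rw [mem_ideal_linear] at hu hv
      rw [eval_mul, derivative_mul, eval_add, eval_mul, eval_mul, pow_two]
      exact ⟨mul_dvd_mul hu hv, dvd_add (hv.mul_left _) (hu.mul_right _)⟩
    · rw [derivative_add, eval_add, eval_add]
      exact ⟨dvd_add hu.1 hv.1, dvd_add hu.2 hv.2⟩
  · rintro ⟨h1, h2⟩
    obtain ⟨g, hg⟩ : X - C a ∣ f - C (f.eval a) := by
      rw [dvd_iff_isRoot, IsRoot.def, eval_sub, eval_C, sub_self]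
    have hg' : f.derivative.eval a = g.eval a := by
      have := congr_arg (fun q => q.derivative.eval a) hg
      simpa using this
    have hX : X - C a ∈ (linear p a).ideal := by simp [mem_ideal_linear]
    have hgI : g ∈ (linear p a).ideal := by rwa [mem_ideal_linear, ← hg']
    obtain ⟨u, hu⟩ := h1
    have hf : f = (X - C a) * g + C (p : ℤ) ^ 2 * C u := by
      rw [← hg, ← C_pow, ← C_mul, ← hu]
      ring
    rw [hf]
    refine Ideal.add_mem _ ?_ (Ideal.mul_mem_right _ _ (Ideal.pow_mem_pow ?_ 2))
    · rw [pow_two]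
      exact Ideal.mul_mem_mul hX hgI
    · simp [mem_ideal_linear]

/-- The quotient is detected by `f(a)` modulo `p ^ 2` and `f'(a)` modulo `p`. -/
theorem card_quotient_ideal_linear_sq (a : ℤ) :
    Nat.card (ℤ[X] ⧸ (linear p a).ideal ^ 2) = p ^ 3 := by
  have hp : p.Prime := Fact.out
  let f : ℤ[X] →+ ZMod (p ^ 2) × ZMod p :=
    ((Int.castRingHom (ZMod (p ^ 2))).comp (evalRingHom a)).toAddMonoidHom.prod
      (((Int.castRingHom (ZMod p)).comp (evalRingHom a)).toAddMonoidHom.comp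
        derivative.toAddMonoidHom)
  have hf (g : ℤ[X]) : f g = (((g.eval a : ℤ) : ZMod (p ^ 2)), ((g.derivative.eval a : ℤ) : ZMod p)) := rfl
  have hs : Function.Surjective f := by
    rintro ⟨u, v⟩
    obtain ⟨u, rfl⟩ := ZMod.intCast_surjective u
    obtain ⟨v, rfl⟩ := ZMod.intCast_surjective v
    refine ⟨C u + C v * (X - C a), ?_⟩
    rw [hf]
    simp
  have hker : f.ker = Submodule.toAddSubgroup ((linear p a).ideal ^ 2) := by
    ext g
    rw [AddMonoidHom.mem_ker, hf, Prod.mk_eq_zero, ZMod.intCast_zmod_eq_zero_iff_dvd,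
      ZMod.intCast_zmod_eq_zero_iff_dvd, Submodule.mem_toAddSubgroup, mem_ideal_linear_sq]
    push_cast
    rfl
  have h1 := AddSubgroup.index_ker f
  rw [hker, AddMonoidHom.range_eq_top.mpr hs] at h1
  refine h1.trans ?_
  rw [AddSubgroup.card_top, Nat.card_prod, Nat.card_zmod, Nat.card_zmod]
  ring

theorem uniformProb_card_cokernel_linear (a : ℤ) (n : ℕ) :
    uniformProb {T : Matrix (Fin n) (Fin n ⊕ Unit) (ℤ[X] ⧸ (linear p a).ideal ^ 2) |
      Nat.card T.Cokernel = p} =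
      1 / (p : ℝ) ^ 2 * (1 - 1 / (p : ℝ) ^ n) *
        ∏ i ∈ Finset.range n, (1 - 1 / (p : ℝ) ^ (i + 2)) := by
  have hp : p.Prime := Fact.out
  set I := (linear p a).ideal with hI
  let 𝔪 : Ideal (ℤ[X] ⧸ I ^ 2) := I.map (Ideal.Quotient.mk (I ^ 2))
  have hle : I ^ 2 ≤ I := Ideal.pow_le_self two_ne_zero
  have : Finite (ℤ[X] ⧸ I ^ 2) := (ProfiniteCompletion.powIdeal I 2).2
  have hmax : 𝔪.IsMaximal := Ideal.IsMaximal.map_of_surjective_of_ker_le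
    Ideal.Quotient.mk_surjective (by rwa [Ideal.mk_ker])
  have h2 : 𝔪 ^ 2 = ⊥ := by
    rw [← Ideal.map_pow, Ideal.map_quotient_self]
  have hk : Nat.card ((ℤ[X] ⧸ I ^ 2) ⧸ 𝔪) = p := by
    rw [Nat.card_congr (DoubleQuot.quotQuotEquivQuotOfLE hle).toEquiv, hI, card_quotient_ideal,
      natDegree_reduction_linear, pow_one]
  have hm : Nat.card 𝔪 = p ^ 2 := by
    have h := Submodule.card_eq_card_quotient_mul_card 𝔪
    rw [hk, card_quotient_ideal_linear_sq a] at h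
    refine Nat.eq_of_mul_eq_mul_right hp.pos ?_
    rw [← h]
    ring
  exact uniformProb_card_cokernel h2 hk hm n (by simp)

end IrredModPoly

/-! ### The Euler product of the zeta function of `K[X]` -/

/-- The monic irreducible polynomials over a field. -/
abbrev MonicIrreducible (K : Type*) [Field K] : Type _ := {g : K[X] // g.Monic ∧ Irreducible g}

section EulerProduct

variable {K : Type*} [Field K]

theorem MonicIrreducible.eq_of_dvd {g h : MonicIrreducible K} (hd : g.1 ∣ h.1) : g = h :=
  Subtype.ext <| eq_of_monic_of_associated g.2.1 h.2.1 (g.2.2.associated_of_dvd h.2.2 hd)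

theorem MonicIrreducible.exists_dvd {f : K[X]} (hf : f.Monic) (h1 : f ≠ 1) :
    ∃ g : MonicIrreducible K, g.1 ∣ f ∧ g.1.natDegree ≤ f.natDegree := by
  obtain ⟨g, hg⟩ := exists_monic_irreducible_factor f (fun h => h1 (hf.eq_one_of_isUnit h))
  exact ⟨⟨g, hg.1, hg.2.1⟩, hg.2.2, natDegree_le_of_dvd hg.2.2 hf.ne_zero⟩

open Classical in
/-- The weight `x ^ deg f` of a monic polynomial `f`, or `0` if a member of `s` divides `f`. -/
noncomputable def coprimeWeight (x : ℝ) (s : Finset (MonicIrreducible K))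
    (f : {f : K[X] // f.Monic}) : ℝ :=
  if ∀ g ∈ s, ¬ g.1 ∣ f.1 then x ^ f.1.natDegree else 0

variable {x : ℝ}

theorem coprimeWeight_empty : coprimeWeight (K := K) x ∅ = fun f => x ^ f.1.natDegree := by
  ext f
  simp [coprimeWeight]

theorem norm_coprimeWeight_le (hx : 0 ≤ x) (s : Finset (MonicIrreducible K))
    (f : {f : K[X] // f.Monic}) : ‖coprimeWeight x s f‖ ≤ x ^ f.1.natDegree := by
  unfold coprimeWeight
  split_ifs
  · rw [Real.norm_of_nonneg (by positivity)]
  · simp only [norm_zero]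
    positivity

variable [Finite K]

instance (n : ℕ) : Finite (degreeLT K n) := Finite.of_equiv _ (degreeLTEquiv K n).toEquiv.symm

/-- Grouping by degree: there are `(Nat.card K) ^ n` monic polynomials of degree `n`, and a
geometric series remains. -/
theorem hasSum_pow_natDegree (hx : 0 ≤ x) (hx1 : Nat.card K * x < 1) :
    HasSum (fun f : {f : K[X] // f.Monic} => x ^ f.1.natDegree) (1 - Nat.card K * x)⁻¹ := by
  let F (n : ℕ) := {f : {f : K[X] // f.Monic} // f.1.natDegree = n}
  let e (n : ℕ) : F n ≃ (Fin n → K) :=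
    (Equiv.subtypeSubtypeEquivSubtypeInter (fun f : K[X] => f.Monic)
      (fun f => f.natDegree = n)).trans ((monicEquivDegreeLT n).trans (degreeLTEquiv K n).toEquiv)
  have (n : ℕ) : Finite (F n) := Finite.of_equiv _ (e n).symm
  have (n : ℕ) : Fintype (F n) := Fintype.ofFinite _
  have hterm (n : ℕ) : HasSum (fun f : F n => x ^ f.1.1.natDegree) ((Nat.card K * x) ^ n) := by
    have h := hasSum_fintype (fun f : F n => x ^ f.1.1.natDegree)
    rw [Finset.sum_congr rfl fun f _ => by rw [f.2], Finset.sum_const, Finset.card_univ,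
      ← Nat.card_eq_fintype_card, Nat.card_congr (e n), Nat.card_fun, Nat.card_fin, nsmul_eq_mul,
      Nat.cast_pow, ← mul_pow] at h
    exact h
  have hgeom := hasSum_geometric_of_lt_one (by positivity : (0 : ℝ) ≤ Nat.card K * x) hx1
  rw [← (Equiv.sigmaFiberEquiv fun f : {f : K[X] // f.Monic} => f.1.natDegree).hasSum_iff]
  refine HasSum.sigma_of_hasSum hgeom hterm ?_
  refine (summable_sigma_of_nonneg fun f => pow_nonneg hx _).mpr
    ⟨fun n => (hterm n).summable, ?_⟩
  have : (fun n => ∑' f : F n, x ^ f.1.1.natDegree) = fun n => (Nat.card K * x) ^ n :=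
    funext fun n => (hterm n).tsum_eq
  exact (this ▸ hgeom.summable)

theorem summable_coprimeWeight (hx : 0 ≤ x) (hx1 : Nat.card K * x < 1)
    (s : Finset (MonicIrreducible K)) : Summable (coprimeWeight x s) :=
  (hasSum_pow_natDegree hx hx1).summable.of_norm_bounded (norm_coprimeWeight_le hx s)

/-- One step of Eratosthenes' sieve. The terms lost on adding `g` are the `g * h` with `h` prime to
`s`, and they carry `x ^ deg g` times the old sum. -/
theorem tsum_coprimeWeight_insert [DecidableEq (MonicIrreducible K)] (hx : 0 ≤ x)
    (hx1 : Nat.card K * x < 1) {s : Finset (MonicIrreducible K)} {g : MonicIrreducible K}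
    (hg : g ∉ s) : ∑' f, coprimeWeight x (insert g s) f =
      (1 - x ^ g.1.natDegree) * ∑' f, coprimeWeight x s f := by
  let μ (h : {f : K[X] // f.Monic}) : {f : K[X] // f.Monic} := ⟨g.1 * h.1, g.2.1.mul h.2⟩
  have hμ : Function.Injective μ := fun h h' hh =>
    Subtype.ext (mul_left_cancel₀ g.2.1.ne_zero (congr_arg Subtype.val hh))
  let r (f : {f : K[X] // f.Monic}) : ℝ := coprimeWeight x s f - coprimeWeight x (insert g s) f
  have hr0 (f : {f : K[X] // f.Monic}) (hf : ¬ g.1 ∣ f.1) : r f = 0 := by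
    have hiff : (∀ g' ∈ insert g s, ¬ g'.1 ∣ f.1) ↔ ∀ g' ∈ s, ¬ g'.1 ∣ f.1 := by
      rw [Finset.forall_mem_insert]
      exact and_iff_right hf
    classical
    exact sub_eq_zero.mpr (if_congr hiff rfl rfl).symm
  have hr1 (f : {f : K[X] // f.Monic}) (hf : g.1 ∣ f.1) : r f = coprimeWeight x s f := by
    have h0 : coprimeWeight x (insert g s) f = 0 :=
      if_neg fun h => h g (Finset.mem_insert_self _ _) hf
    simp only [r, h0, sub_zero]
  have hsupp : Function.support r ⊆ Set.range μ := by
    intro f hf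
    obtain ⟨h, hh⟩ : g.1 ∣ f.1 := by
      by_contra hd
      exact hf (hr0 f hd)
    exact ⟨⟨h, g.2.1.of_mul_monic_left (hh ▸ f.2)⟩, Subtype.ext hh.symm⟩
  have hrμ (h : {f : K[X] // f.Monic}) :
      r (μ h) = x ^ g.1.natDegree * coprimeWeight x s h := by
    rw [hr1 _ (dvd_mul_right _ _)]
    have hiff : (∀ g' ∈ s, ¬ g'.1 ∣ (μ h).1) ↔ ∀ g' ∈ s, ¬ g'.1 ∣ h.1 := by
      refine forall₂_congr fun g' hg' => not_congr ?_
      rw [g'.2.2.prime.dvd_mul]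
      refine or_iff_right fun hd => hg ?_
      rwa [← MonicIrreducible.eq_of_dvd hd]
    classical
    refine (if_congr hiff rfl rfl).trans ?_
    simp only [coprimeWeight, μ, g.2.1.natDegree_mul h.2, pow_add, mul_ite, mul_zero]
  have h1 := hμ.tsum_eq hsupp
  simp_rw [hrμ] at h1
  rw [tsum_mul_left, (summable_coprimeWeight hx hx1 s).tsum_sub
    (summable_coprimeWeight hx hx1 (insert g s))] at h1
  linear_combination h1

theorem tsum_coprimeWeight (hx : 0 ≤ x) (hx1 : Nat.card K * x < 1)
    (s : Finset (MonicIrreducible K)) : ∑' f, coprimeWeight x s f =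
      (∏ g ∈ s, (1 - x ^ g.1.natDegree)) * (1 - Nat.card K * x)⁻¹ := by
  classical
  induction s using Finset.induction_on with
  | empty => rw [coprimeWeight_empty, (hasSum_pow_natDegree hx hx1).tsum_eq, Finset.prod_empty,
      one_mul]
  | insert g s hg ih =>
    rw [tsum_coprimeWeight_insert hx hx1 hg, Finset.prod_insert hg, ih, mul_assoc]

variable (K) in
theorem MonicIrreducible.finite_natDegree_le (N : ℕ) :
    {g : MonicIrreducible K | g.1.natDegree ≤ N}.Finite := by
  have : Set.Finite {f : K[X] | f ∈ degreeLT K (N + 1)} :=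
    Set.finite_coe_iff.mp (inferInstanceAs (Finite (degreeLT K (N + 1))))
  refine Set.Finite.of_finite_image (f := Subtype.val) (this.subset ?_)
    Subtype.val_injective.injOn
  rintro _ ⟨g, hg, rfl⟩
  exact mem_degreeLT.mpr
    (degree_le_natDegree.trans_lt (by exact_mod_cast Nat.lt_succ_of_le hg))

variable (K) in
/-- The monic irreducible polynomials of degree at most `N` over a finite field. -/
noncomputable def MonicIrreducible.natDegreeLE (N : ℕ) : Finset (MonicIrreducible K) :=
  (MonicIrreducible.finite_natDegree_le K N).toFinset

theorem MonicIrreducible.mem_natDegreeLE {N : ℕ} {g : MonicIrreducible K} :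
    g ∈ natDegreeLE K N ↔ g.1.natDegree ≤ N := by
  simp [natDegreeLE]

/-- Every monic `f ≠ 1` is eventually sieved out, so only `f = 1` survives in the limit; the full
series dominates. -/
theorem tendsto_prod_one_sub_pow_natDegree (hx : 0 ≤ x) (hx1 : Nat.card K * x < 1) :
    Tendsto (fun N => ∏ g ∈ MonicIrreducible.natDegreeLE K N, (1 - x ^ g.1.natDegree)) atTop
      (𝓝 (1 - Nat.card K * x)) := by
  classical
  let one : {f : K[X] // f.Monic} := ⟨1, monic_one⟩
  have hlim : Tendsto
      (fun N => ∑' f, coprimeWeight x (MonicIrreducible.natDegreeLE K N) f) atTop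
      (𝓝 (∑' f, if f = one then (1 : ℝ) else 0)) := by
    refine tendsto_tsum_of_dominated_convergence (hasSum_pow_natDegree hx hx1).summable
      (fun f => ?_) (Eventually.of_forall fun N f => norm_coprimeWeight_le hx _ f)
    refine tendsto_const_nhds.congr' ?_
    filter_upwards [eventually_ge_atTop f.1.natDegree] with N hN
    by_cases hf : f = one
    · rw [if_pos hf, hf, coprimeWeight, if_pos]
      · simp [one]
      · exact fun g _ hd => g.2.2.not_dvd_one hd
    · rw [if_neg hf, coprimeWeight, if_neg]
      intro h
      obtain ⟨g, hg, hd⟩ := MonicIrreducible.exists_dvd f.2 fun h => hf (Subtype.ext h)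
      exact h g (MonicIrreducible.mem_natDegreeLE.mpr (hd.trans hN)) hg
  rw [tsum_ite_eq] at hlim
  simp_rw [tsum_coprimeWeight hx hx1] at hlim
  have hne : (1 : ℝ) - Nat.card K * x ≠ 0 := (sub_pos.mpr hx1).ne'
  have := hlim.mul_const (1 - Nat.card K * x)
  simpa [mul_assoc, inv_mul_cancel₀ hne] using this

end EulerProduct

/-! ### Haar measure and finite quotients -/

/-- The fibres of `f` are translates of one another, so they share the total mass equally. -/
theorem measureReal_preimage_eq_uniformProb {G H : Type*} [AddGroup G] [AddGroup H] [Finite H]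
    [MeasurableSpace G] [MeasurableAdd G] (μ : Measure G) [IsProbabilityMeasure μ]
    [μ.IsAddLeftInvariant] (f : G →+ H) (hf : Function.Surjective f)
    (hm : ∀ h, MeasurableSet (f ⁻¹' {h})) (B : Set H) : μ.real (f ⁻¹' B) = uniformProb B := by
  classical
  have := Fintype.ofFinite H
  have hc (h : H) : μ.real (f ⁻¹' {h}) = μ.real (f ⁻¹' {0}) := by
    obtain ⟨g, rfl⟩ := hf h
    rw [measureReal_def, measureReal_def, ← measure_preimage_add μ (-g) (f ⁻¹' {0})]
    congr 2
    ext x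
    simp only [Set.mem_preimage, Set.mem_singleton_iff, map_add, map_neg, neg_add_eq_zero]
    exact eq_comm
  have hs (s : Finset H) : μ.real (f ⁻¹' s) = s.card * μ.real (f ⁻¹' {0}) := by
    rw [← sum_measureReal_preimage_singleton s fun h _ => hm h, Finset.sum_congr rfl fun h _ => hc h,
      Finset.sum_const, nsmul_eq_mul]
  have h1 := hs Finset.univ
  rw [Finset.coe_univ, Set.preimage_univ, probReal_univ, Finset.card_univ] at h1
  have h2 := hs B.toFinset
  rw [Set.coe_toFinset] at h2
  rw [h2, uniformProb, Nat.card_eq_fintype_card, Nat.card_eq_fintype_card, Set.toFinset_card,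
    eq_div_iff (by exact_mod_cast Fintype.card_ne_zero)]
  linear_combination (Fintype.card B : ℝ) * -h1

section Haar

variable {G : Type*} [AddGroup G] [TopologicalSpace G] [IsTopologicalAddGroup G] [CompactSpace G]
  [MeasurableSpace G] [BorelSpace G]

instance : (haarProbability G).IsAddLeftInvariant :=
  inferInstanceAs (Measure.addHaarMeasure ⊤).IsAddLeftInvariant

instance : IsProbabilityMeasure (haarProbability G) :=
  ⟨Measure.addHaarMeasure_self⟩

end Haar

namespace ProfiniteCompletion

theorem measurableSet_proj_eq {R : Type*} [CommRing R] (I : FiniteIndexIdeal R) (c : R ⧸ I.1) :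
    MeasurableSet {r : ProfiniteCompletion R | proj I r = c} := by
  refine IsOpen.measurableSet ?_
  let (I : FiniteIndexIdeal R) : TopologicalSpace (R ⧸ I.1) := ⊥
  have (I : FiniteIndexIdeal R) : DiscreteTopology (R ⧸ I.1) := ⟨rfl⟩
  have hind : IsInducing (toPi (R := R)) := ⟨rfl⟩
  exact (isOpen_discrete {c}).preimage ((continuous_apply I).comp hind.continuous)

variable {R : Type*} [CommRing R] [Countable R] [IsNoetherianRing R] {m n : Type*} [Finite m]
  [Finite n]

instance : MeasurableAdd₂ (Matrix m n (ProfiniteCompletion R)) :=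
  have : SecondCountableTopology (Matrix m n (ProfiniteCompletion R)) :=
    inferInstanceAs (SecondCountableTopology (m → n → ProfiniteCompletion R))
  inferInstance

end ProfiniteCompletion

/-! ### The law of the walk matrix modulo ideals of finite index. -/

section Walk

open ProfiniteCompletion

variable {n : ℕ}

/-- The joint law of the matrix and the vector. -/
noncomputable abbrev haarPair (n : ℕ) : Measure
    (Matrix (Fin n) (Fin n) (ProfiniteCompletion ℤ[X]) × (Fin n → ProfiniteCompletion ℤ[X])) :=
  (haarProbability (Matrix (Fin n) (Fin n) (ProfiniteCompletion ℤ[X]))).prod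
    (haarProbability (Fin n → ProfiniteCompletion ℤ[X]))

/-- The `n × (n + 1)` matrix `(M, ζ)`, reduced modulo an ideal of finite index. -/
noncomputable def appendColMod (I : FiniteIndexIdeal ℤ[X]) :
    Matrix (Fin n) (Fin n) (ProfiniteCompletion ℤ[X]) × (Fin n → ProfiniteCompletion ℤ[X]) →+
      Matrix (Fin n) (Fin n ⊕ Unit) (ℤ[X] ⧸ I.1) where
  toFun x := (Matrix.fromCols x.1 (Matrix.replicateCol Unit x.2)).map (proj I)
  map_zero' := by
    ext i (j | j) <;> simp
  map_add' x y := by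
    ext i (j | j) <;> simp

/-- The shift by `x I` becomes a fixed translation, which cannot change a uniform distribution. -/
theorem walkMatrix_map_proj (I : FiniteIndexIdeal ℤ[X])
    (x : Matrix (Fin n) (Fin n) (ProfiniteCompletion ℤ[X]) × (Fin n → ProfiniteCompletion ℤ[X])) :
    (walkMatrix x.1 x.2).map (proj I) =
      appendColMod I x - appendColMod I (of (X : ℤ[X]) • 1, 0) := by
  ext i (j | j) <;> simp [walkMatrix, appendColMod]

theorem measurableSet_appendColMod_eq (I : FiniteIndexIdeal ℤ[X])
    (A : Matrix (Fin n) (Fin n ⊕ Unit) (ℤ[X] ⧸ I.1)) :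
    MeasurableSet {x | appendColMod I x = A} := by
  have : {x | appendColMod I x = A} = (⋂ i, ⋂ j, {x | proj I (x.1 i j) = A i (Sum.inl j)}) ∩
      ⋂ i, {x | proj I (x.2 i) = A i (Sum.inr ())} := by
    ext x
    simp only [Set.mem_ofPred_eq, Set.mem_inter_iff, Set.mem_iInter]
    rw [← Matrix.ext_iff, ← forall_and]
    exact forall_congr' fun i => ⟨fun h => ⟨fun j => h (Sum.inl j), h (Sum.inr ())⟩,
      fun h j => j.casesOn h.1 fun _ => h.2⟩
  rw [this]
  refine (MeasurableSet.iInter fun i => MeasurableSet.iInter fun j => ?_).inter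
    (MeasurableSet.iInter fun i => ?_)
  · have hm : Measurable fun x : Matrix (Fin n) (Fin n) (ProfiniteCompletion ℤ[X]) ×
        (Fin n → ProfiniteCompletion ℤ[X]) => x.1 i j :=
      (show Measurable fun A : Fin n → Fin n → ProfiniteCompletion ℤ[X] => A i j by fun_prop).comp
        measurable_fst
    exact hm (measurableSet_proj_eq I _)
  · have hm : Measurable fun x : Matrix (Fin n) (Fin n) (ProfiniteCompletion ℤ[X]) ×
        (Fin n → ProfiniteCompletion ℤ[X]) => x.2 i :=
      (measurable_pi_apply i).comp measurable_snd
    exact hm (measurableSet_proj_eq I _)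

theorem measurableSet_walkMatrix_map_proj (I : FiniteIndexIdeal ℤ[X])
    (B : Set (Matrix (Fin n) (Fin n ⊕ Unit) (ℤ[X] ⧸ I.1))) :
    MeasurableSet {x : Matrix (Fin n) (Fin n) (ProfiniteCompletion ℤ[X]) ×
      (Fin n → ProfiniteCompletion ℤ[X]) | (walkMatrix x.1 x.2).map (proj I) ∈ B} := by
  have := I.2
  have h : {x : Matrix (Fin n) (Fin n) (ProfiniteCompletion ℤ[X]) ×
      (Fin n → ProfiniteCompletion ℤ[X]) | (walkMatrix x.1 x.2).map (proj I) ∈ B} =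
      ⋃ A ∈ B, {x | appendColMod I x = A + appendColMod I (of (X : ℤ[X]) • 1, 0)} := by
    ext x
    simp [walkMatrix_map_proj, ← sub_eq_iff_eq_add]
  rw [h]
  exact (Set.toFinite B).measurableSet_biUnion fun A _ => measurableSet_appendColMod_eq I _

/-- The Chinese remainder theorem makes the joint reduction surjective, hence uniform on the
product: reductions modulo coprime ideals are independent. -/
theorem haarPair_real_forall_walkMatrix_map_proj_mem {ι : Type*} [Fintype ι]
    {I : ι → FiniteIndexIdeal ℤ[X]} (hI : Pairwise fun i j => IsCoprime (I i).1 (I j).1)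
    (B : ∀ i, Set (Matrix (Fin n) (Fin n ⊕ Unit) (ℤ[X] ⧸ (I i).1))) :
    (haarPair n).real {x | ∀ i, (walkMatrix x.1 x.2).map (proj (I i)) ∈ B i} =
      ∏ i, uniformProb (B i) := by
  have (i : ι) := (I i).2
  let f : Matrix (Fin n) (Fin n) (ProfiniteCompletion ℤ[X]) ×
      (Fin n → ProfiniteCompletion ℤ[X]) →+
      ∀ i, Matrix (Fin n) (Fin n ⊕ Unit) (ℤ[X] ⧸ (I i).1) :=
    AddMonoidHom.pi fun i => appendColMod (I i)
  have hs : Function.Surjective f := by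
    intro A
    choose r hr using fun (a : Fin n) (b : Fin n ⊕ Unit) =>
      Ideal.pi_quotient_surjective hI fun i => A i a b
    refine ⟨(Matrix.of fun a b => of (r a (Sum.inl b)), fun a => of (r a (Sum.inr ()))), ?_⟩
    ext i a (b | b)
    · exact hr a (Sum.inl b) i
    · exact hr a (Sum.inr b) i
  have hm (A) : MeasurableSet (f ⁻¹' {A}) := by
    have : f ⁻¹' {A} = ⋂ i, {x | appendColMod (I i) x = A i} := by
      ext x
      simp [f, funext_iff]
    rw [this]
    exact MeasurableSet.iInter fun i => measurableSet_appendColMod_eq _ _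
  rw [← uniformProb_pi, ← uniformProb_preimage_equiv
    (Equiv.subRight (f (of (X : ℤ[X]) • 1, 0))) (Set.univ.pi B),
    ← measureReal_preimage_eq_uniformProb (haarPair n) f hs hm]
  congr 1
  ext x
  simp [walkMatrix_map_proj, f]

end Walk

/-! ### Condition `W_p` in terms of finite quotients -/

namespace MonicIrreducible

variable {p : ℕ} [Fact p.Prime]

theorem exists_reduction_eq (g : MonicIrreducible (ZMod p)) :
    ∃ β : IrredModPoly p, β.reduction = g.1 := by
  obtain ⟨f, hf, -, hm⟩ := lifts_and_natDegree_eq_and_monic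
    (mem_lifts_of_surjective (ZMod.ringHom_surjective (Int.castRingHom (ZMod p))) g.1) g.2.1
  exact ⟨⟨f, hm, hf ▸ g.2.2⟩, hf⟩

/-- A monic irreducible polynomial as the reduction of a monic integral polynomial. -/
noncomputable def lift (g : MonicIrreducible (ZMod p)) : IrredModPoly p :=
  g.exists_reduction_eq.choose

theorem reduction_lift (g : MonicIrreducible (ZMod p)) : g.lift.reduction = g.1 :=
  g.exists_reduction_eq.choose_spec

/-- The square of the maximal ideal `(p, g)` of `ℤ[X]`. -/
noncomputable abbrev sqIdeal (g : MonicIrreducible (ZMod p)) : FiniteIndexIdeal ℤ[X] :=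
  ProfiniteCompletion.powIdeal g.lift.ideal 2

/-- The polynomial `X - a`. -/
noncomputable def linear (a : ZMod p) : MonicIrreducible (ZMod p) :=
  ⟨X - C a, monic_X_sub_C a, irreducible_X_sub_C a⟩

theorem natDegree_linear (a : ZMod p) : (linear a).1.natDegree = 1 := natDegree_X_sub_C a

theorem linear_injective : Function.Injective (linear (p := p)) := fun _ _ h =>
  C_injective (sub_right_injective (congr_arg Subtype.val h))

/-- Distinct maximal ideals are coprime, and so are their powers; if the ideals agreed, one
irreducible would divide the other. -/
theorem isCoprime_sqIdeal {g h : MonicIrreducible (ZMod p)} (hgh : g ≠ h) :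
    IsCoprime g.sqIdeal.1 h.sqIdeal.1 := by
  refine IsCoprime.pow (Ideal.isCoprime_of_isMaximal fun hI => hgh (eq_of_dvd ?_).symm)
  have h1 : g.lift.poly ∈ h.lift.ideal := hI ▸ Ideal.subset_span (by simp)
  rw [IrredModPoly.ideal_eq_comap, Ideal.mem_comap, Ideal.mem_span_singleton, reduction_lift] at h1
  exact h1.trans (reduction_lift g).dvd

end MonicIrreducible

theorem IrredModPoly.ideal_eq_of_reduction_eq {p : ℕ} [Fact p.Prime] {β β' : IrredModPoly p}
    (h : β.reduction = β'.reduction) : β.ideal = β'.ideal := by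
  rw [ideal_eq_comap, ideal_eq_comap, h]

theorem IrredModPoly.reduction_linear {p : ℕ} [Fact p.Prime] (a : ℤ) :
    (IrredModPoly.linear p a).reduction = (MonicIrreducible.linear (a : ZMod p)).1 := by
  rw [reduction, linear, Polynomial.map_sub, map_X, map_C, MonicIrreducible.linear, eq_intCast]

section ConditionW

open ProfiniteCompletion

variable {p : ℕ} [Fact p.Prime] {n : ℕ}

theorem surjective_map_proj_congr {I J : Ideal ℤ[X]} [Finite (ℤ[X] ⧸ I)] [Finite (ℤ[X] ⧸ J)]
    (h : I = J) {m k : Type*} [Fintype k] (T : Matrix m k (ProfiniteCompletion ℤ[X])) :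
    Function.Surjective (T.map (proj (powIdeal I 2))).mulVec ↔
      Function.Surjective (T.map (proj (powIdeal J 2))).mulVec := by
  subst h
  rfl

theorem card_cokernel_map_proj_congr {I J : Ideal ℤ[X]} [Finite (ℤ[X] ⧸ I)]
    [Finite (ℤ[X] ⧸ J)] (h : I = J) {m k : Type*} [Fintype k]
    (T : Matrix m k (ProfiniteCompletion ℤ[X])) :
    Nat.card (T.map (proj (powIdeal I 2))).Cokernel =
      Nat.card (T.map (proj (powIdeal J 2))).Cokernel := by
  subst h
  rfl

open Classical in
/-- The matrices over `ℤ[X] / (p, g) ^ 2` allowed by condition `W_p`: all cokernels vanish if `a`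
is `none`, and the cokernel at `X - a` has order `p` while the others vanish if `a` is given. -/
def allowedMatrices (n : ℕ) (a : Option (ZMod p)) (g : MonicIrreducible (ZMod p)) :
    Set (Matrix (Fin n) (Fin n ⊕ Unit) (ℤ[X] ⧸ g.sqIdeal.1)) :=
  if a.map MonicIrreducible.linear = some g then {T | Nat.card T.Cokernel = p}
  else {T | Function.Surjective T.mulVec}

theorem allowedMatrices_none (g : MonicIrreducible (ZMod p)) :
    allowedMatrices n none g = {T | Function.Surjective T.mulVec} := if_neg (by simp)

theorem allowedMatrices_linear (a : ZMod p) :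
    allowedMatrices n (some a) (MonicIrreducible.linear a) = {T | Nat.card T.Cokernel = p} :=
  if_pos rfl

theorem allowedMatrices_of_ne {a : ZMod p} {g : MonicIrreducible (ZMod p)}
    (h : g ≠ MonicIrreducible.linear a) :
    allowedMatrices n (some a) g = {T | Function.Surjective T.mulVec} :=
  if_neg fun h' => h (Option.some_injective _ h').symm

theorem disjoint_allowedMatrices {a : ZMod p} {b : Option (ZMod p)} (h : some a ≠ b) :
    Disjoint (allowedMatrices n (some a) (MonicIrreducible.linear a))
      (allowedMatrices n b (MonicIrreducible.linear a)) := by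
  have hb : allowedMatrices n b (MonicIrreducible.linear a) =
      {T | Function.Surjective T.mulVec} := by
    cases b with
    | none => exact allowedMatrices_none _
    | some b =>
      exact allowedMatrices_of_ne fun h' =>
        h (congr_arg some (MonicIrreducible.linear_injective h'))
  rw [hb, allowedMatrices_linear, Set.disjoint_left]
  intro T hT hs
  have := (Matrix.Cokernel.subsingleton_iff T).mpr hs
  exact (Fact.out : p.Prime).one_lt.ne' ((hT : Nat.card T.Cokernel = p).symm.trans
    (Nat.card_of_subsingleton (0 : T.Cokernel)))

/-- The local criteria depend on `β` only through its reduction and on `a` only modulo `p`, so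
`none` encodes (W1) and `some a` encodes (W2). -/
theorem conditionW_iff (T : Matrix (Fin n) (Fin n ⊕ Unit) (ProfiniteCompletion ℤ[X])) :
    ConditionW p T.Cokernel ↔
      ∃ a : Option (ZMod p), ∀ g, T.map (proj g.sqIdeal) ∈ allowedMatrices n a g := by
  have hβ (β : IrredModPoly p) (g : MonicIrreducible (ZMod p)) (h : β.reduction = g.1) :
      Subsingleton (T.Cokernel ⊗[ProfiniteCompletion ℤ[X]] β.LocalRing) ↔
        Function.Surjective (T.map (proj g.sqIdeal)).mulVec :=
    (β.subsingleton_tensor_iff T).trans (surjective_map_proj_congr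
      (IrredModPoly.ideal_eq_of_reduction_eq (h.trans g.reduction_lift.symm)) T)
  have hlin (a : ℤ) : Nonempty ((T.Cokernel ⊗[ProfiniteCompletion ℤ[X]]
      (IrredModPoly.linear p a).LocalRing) ≃ₗ[ProfiniteCompletion ℤ[X]]
        (IrredModPoly.linear p a).Residue) ↔
      Nat.card (T.map (proj (MonicIrreducible.linear (a : ZMod p)).sqIdeal)).Cokernel = p := by
    rw [IrredModPoly.nonempty_tensor_equiv_iff _ _ (by
      rw [IrredModPoly.card_residue, IrredModPoly.natDegree_reduction_linear, pow_one]),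
      card_cokernel_map_proj_congr (IrredModPoly.ideal_eq_of_reduction_eq
        ((IrredModPoly.reduction_linear a).trans (MonicIrreducible.reduction_lift _).symm)) T]
  rw [Option.exists]
  refine or_congr ?_ ?_
  · simp only [allowedMatrices_none]
    constructor
    · exact fun h g => (hβ g.lift g g.reduction_lift).mp (h _)
    · exact fun h β => (hβ β ⟨β.reduction, β.monic.map _, β.irreducible⟩ rfl).mpr (h _)
  · refine Iff.trans (exists_congr fun a => ?_) (ZMod.intCast_surjective (n := p)).exists.symm
    constructor
    · rintro ⟨h1, h2⟩ g
      by_cases hg : g = MonicIrreducible.linear (a : ZMod p)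
      · subst hg
        rw [allowedMatrices_linear]
        exact (hlin a).mp h1
      · rw [allowedMatrices_of_ne hg]
        refine (hβ g.lift g g.reduction_lift).mp (h2 _ fun h => hg (Subtype.ext ?_))
        rw [← g.reduction_lift, h, IrredModPoly.reduction_linear]
    · intro h
      refine ⟨(hlin a).mpr ?_, fun β hne => ?_⟩
      · have := h (MonicIrreducible.linear (a : ZMod p))
        rwa [allowedMatrices_linear] at this
      · have := h ⟨β.reduction, β.monic.map _, β.irreducible⟩
        rw [allowedMatrices_of_ne] at this
        · exact (hβ β _ rfl).mpr this
        · intro h'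
          exact hne ((congr_arg Subtype.val h').trans (IrredModPoly.reduction_linear a).symm)

theorem uniformProb_surjective_sqIdeal (g : MonicIrreducible (ZMod p)) :
    uniformProb {T : Matrix (Fin n) (Fin n ⊕ Unit) (ℤ[X] ⧸ g.sqIdeal.1) |
      Function.Surjective T.mulVec} =
      ∏ i ∈ Finset.range n, (1 - (1 / (p : ℝ) ^ (i + 2)) ^ g.1.natDegree) := by
  rw [← g.reduction_lift]
  exact IrredModPoly.uniformProb_surjective g.lift n

theorem uniformProb_card_cokernel_sqIdeal (a : ZMod p) :
    uniformProb {T : Matrix (Fin n) (Fin n ⊕ Unit)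
        (ℤ[X] ⧸ (MonicIrreducible.linear a).sqIdeal.1) | Nat.card T.Cokernel = p} =
      1 / (p : ℝ) ^ 2 * (1 - 1 / (p : ℝ) ^ n) *
        uniformProb {T : Matrix (Fin n) (Fin n ⊕ Unit)
          (ℤ[X] ⧸ (MonicIrreducible.linear a).sqIdeal.1) | Function.Surjective T.mulVec} := by
  obtain ⟨a, rfl⟩ := ZMod.intCast_surjective a
  -- The chosen lift of `X - a` need not be `X - a` itself; only the ideals agree, hence the
  -- statement for a variable `I`.
  have key (I : Ideal ℤ[X]) (hI : I = (IrredModPoly.linear p a).ideal) :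
      uniformProb {T : Matrix (Fin n) (Fin n ⊕ Unit) (ℤ[X] ⧸ I ^ 2) | Nat.card T.Cokernel = p} =
        1 / (p : ℝ) ^ 2 * (1 - 1 / (p : ℝ) ^ n) *
          ∏ i ∈ Finset.range n, (1 - 1 / (p : ℝ) ^ (i + 2)) := by
    subst hI
    exact IrredModPoly.uniformProb_card_cokernel_linear a n
  rw [uniformProb_surjective_sqIdeal, MonicIrreducible.natDegree_linear]
  simp only [pow_one]
  exact key _ (IrredModPoly.ideal_eq_of_reduction_eq
    ((MonicIrreducible.reduction_lift _).trans (IrredModPoly.reduction_linear a).symm))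

end ConditionW

/-! ### Exact probabilities and the passage to infinitely many primes. -/

section Limit

open ProfiniteCompletion

variable {p : ℕ} [Fact p.Prime] {n : ℕ}

/-- The event that all reductions of `(M - x I, ζ)` modulo the squares of the maximal ideals
containing `p` lie in given sets. -/
def walkEvent (B : ∀ g : MonicIrreducible (ZMod p),
    Set (Matrix (Fin n) (Fin n ⊕ Unit) (ℤ[X] ⧸ g.sqIdeal.1))) :
    Set (Matrix (Fin n) (Fin n) (ProfiniteCompletion ℤ[X]) ×
      (Fin n → ProfiniteCompletion ℤ[X])) :=
  {x | ∀ g : MonicIrreducible (ZMod p), (walkMatrix x.1 x.2).map (proj g.sqIdeal) ∈ B g}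

variable (B : ∀ g : MonicIrreducible (ZMod p),
    Set (Matrix (Fin n) (Fin n ⊕ Unit) (ℤ[X] ⧸ g.sqIdeal.1)))

theorem walkEvent_eq_iInter : walkEvent B =
    ⋂ N, {x | ∀ g : MonicIrreducible.natDegreeLE (ZMod p) N,
      (walkMatrix x.1 x.2).map (proj g.1.sqIdeal) ∈ B g.1} := by
  ext x
  simp only [walkEvent, Set.mem_ofPred_eq, Set.mem_iInter]
  exact ⟨fun h N g => h g.1, fun h g =>
    h g.1.natDegree ⟨g, MonicIrreducible.mem_natDegreeLE.mpr le_rfl⟩⟩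

theorem measurableSet_walkEvent_natDegreeLE (N : ℕ) :
    MeasurableSet {x : Matrix (Fin n) (Fin n) (ProfiniteCompletion ℤ[X]) ×
      (Fin n → ProfiniteCompletion ℤ[X]) | ∀ g : MonicIrreducible.natDegreeLE (ZMod p) N,
        (walkMatrix x.1 x.2).map (proj g.1.sqIdeal) ∈ B g.1} := by
  rw [Set.ofPred_forall]
  exact MeasurableSet.iInter fun g => measurableSet_walkMatrix_map_proj _ _

theorem measurableSet_walkEvent : MeasurableSet (walkEvent B) := by
  rw [walkEvent_eq_iInter]
  exact MeasurableSet.iInter fun N => measurableSet_walkEvent_natDegreeLE B N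

/-- Continuity of the measure from above, along the decreasing events that only involve `g` of
degree at most `N`. -/
theorem haarPair_real_walkEvent {l : ℝ} (hl : Tendsto
    (fun N => ∏ g ∈ MonicIrreducible.natDegreeLE (ZMod p) N, uniformProb (B g)) atTop (𝓝 l)) :
    (haarPair n).real (walkEvent B) = l := by
  refine tendsto_nhds_unique ?_ hl
  have h := tendsto_measure_iInter_atTop (μ := haarPair n)
    (fun N => (measurableSet_walkEvent_natDegreeLE B N).nullMeasurableSet)
    (fun N N' hN x hx g => hx ⟨g.1, MonicIrreducible.mem_natDegreeLE.mpr
      ((MonicIrreducible.mem_natDegreeLE.mp g.2).trans hN)⟩) ⟨0, measure_ne_top _ _⟩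
  rw [← walkEvent_eq_iInter] at h
  refine ((ENNReal.tendsto_toReal (measure_ne_top _ _)).comp h).congr fun N => ?_
  rw [← Finset.prod_coe_sort]
  exact haarPair_real_forall_walkMatrix_map_proj_mem
    (I := fun g : MonicIrreducible.natDegreeLE (ZMod p) N => g.1.sqIdeal)
    (fun g h hgh => MonicIrreducible.isCoprime_sqIdeal fun h' => hgh (Subtype.ext h')) _

variable (p n) in
-- Exchanging the two finite products leaves, for each `i < n`, the Euler product at `x = 1 / p ^ (i
-- + 2)`, with limit `1 - p x`.
theorem tendsto_prod_uniformProb_surjective :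
    Tendsto (fun N => ∏ g ∈ MonicIrreducible.natDegreeLE (ZMod p) N,
      uniformProb {T : Matrix (Fin n) (Fin n ⊕ Unit) (ℤ[X] ⧸ g.sqIdeal.1) |
        Function.Surjective T.mulVec}) atTop
      (𝓝 (∏ i ∈ Finset.range n, (1 - 1 / (p : ℝ) ^ (i + 1)))) := by
  have hp : p.Prime := Fact.out
  have hp0 : (p : ℝ) ≠ 0 := by exact_mod_cast hp.ne_zero
  have hp1 : (1 : ℝ) < p := by exact_mod_cast hp.one_lt
  have hx (i : ℕ) : (Nat.card (ZMod p) : ℝ) * (1 / (p : ℝ) ^ (i + 2)) = 1 / (p : ℝ) ^ (i + 1) := by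
    rw [Nat.card_zmod]
    field_simp
    ring
  refine Tendsto.congr (fun N => Finset.prod_comm.trans (Finset.prod_congr rfl fun g _ =>
    (uniformProb_surjective_sqIdeal g).symm)) (tendsto_finsetProd _ fun i _ => ?_)
  have hlt : (Nat.card (ZMod p) : ℝ) * (1 / (p : ℝ) ^ (i + 2)) < 1 := by
    rw [hx, one_div]
    exact inv_lt_one_of_one_lt₀ (one_lt_pow₀ hp1 (Nat.succ_ne_zero i))
  have h := tendsto_prod_one_sub_pow_natDegree (K := ZMod p) (by positivity) hlt
  rwa [hx] at h

theorem haarPair_real_walkEvent_none :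
    (haarPair n).real (walkEvent (allowedMatrices (p := p) n none)) =
      ∏ i ∈ Finset.range n, (1 - 1 / (p : ℝ) ^ (i + 1)) := by
  refine haarPair_real_walkEvent _ ?_
  simp_rw [allowedMatrices_none]
  exact tendsto_prod_uniformProb_surjective p n

/-- Only the factor at `X - a` differs from the surjective case, and it is present as soon as `N ≥
1`. -/
theorem haarPair_real_walkEvent_some (a : ZMod p) :
    (haarPair n).real (walkEvent (allowedMatrices n (some a))) =
      1 / (p : ℝ) ^ 2 * (1 - 1 / (p : ℝ) ^ n) *
        ∏ i ∈ Finset.range n, (1 - 1 / (p : ℝ) ^ (i + 1)) := by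
  classical
  refine haarPair_real_walkEvent _ ?_
  refine ((tendsto_prod_uniformProb_surjective p n).const_mul
    (1 / (p : ℝ) ^ 2 * (1 - 1 / (p : ℝ) ^ n))).congr' ?_
  filter_upwards [eventually_ge_atTop 1] with N hN
  have hmem : MonicIrreducible.linear a ∈ MonicIrreducible.natDegreeLE (ZMod p) N :=
    MonicIrreducible.mem_natDegreeLE.mpr ((MonicIrreducible.natDegree_linear a).trans_le hN)
  rw [← Finset.mul_prod_erase _ _ hmem, ← Finset.mul_prod_erase _ _ hmem, ← mul_assoc,
    ← uniformProb_card_cokernel_sqIdeal, allowedMatrices_linear]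
  congr 1
  refine Finset.prod_congr rfl fun g hg => ?_
  rw [allowedMatrices_of_ne (Finset.ne_of_mem_erase hg)]

theorem setOf_conditionW_eq :
    {x : Matrix (Fin n) (Fin n) (ProfiniteCompletion ℤ[X]) ×
      (Fin n → ProfiniteCompletion ℤ[X]) | ConditionW p (walkMatrix x.1 x.2).Cokernel} =
      ⋃ a : Option (ZMod p), walkEvent (allowedMatrices n a) := by
  ext x
  simp only [Set.mem_ofPred_eq, Set.mem_iUnion]
  exact conditionW_iff _

theorem measurableSet_conditionW :
    MeasurableSet {x : Matrix (Fin n) (Fin n) (ProfiniteCompletion ℤ[X]) ×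
      (Fin n → ProfiniteCompletion ℤ[X]) | ConditionW p (walkMatrix x.1 x.2).Cokernel} := by
  rw [setOf_conditionW_eq]
  exact MeasurableSet.iUnion fun a => measurableSet_walkEvent _

theorem pairwise_disjoint_walkEvent : Pairwise fun a b : Option (ZMod p) =>
    Disjoint (walkEvent (allowedMatrices n a)) (walkEvent (allowedMatrices n b)) := by
  have key (a : ZMod p) (b : Option (ZMod p)) (h : some a ≠ b) :
      Disjoint (walkEvent (allowedMatrices n (some a))) (walkEvent (allowedMatrices n b)) :=
    Set.disjoint_left.mpr fun x ha hb =>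
      Set.disjoint_left.mp (disjoint_allowedMatrices h) (ha _) (hb _)
  rintro (_ | a) b h
  · cases b with
    | none => exact absurd rfl h
    | some b => exact (key b none h.symm).symm
  · exact key a b h

/-- The exact probability of condition `W_p` for every `n`. -/
theorem haarPair_real_conditionW :
    (haarPair n).real {x | ConditionW p (walkMatrix x.1 x.2).Cokernel} =
      (1 + 1 / (p : ℝ) * (1 - 1 / (p : ℝ) ^ n)) *
        ∏ i ∈ Finset.range n, (1 - 1 / (p : ℝ) ^ (i + 1)) := by
  have hp0 : (p : ℝ) ≠ 0 := by exact_mod_cast (Fact.out : p.Prime).ne_zero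
  rw [setOf_conditionW_eq, measureReal_iUnion_fintype pairwise_disjoint_walkEvent
    fun a => measurableSet_walkEvent _, Fintype.sum_option, haarPair_real_walkEvent_none]
  simp_rw [haarPair_real_walkEvent_some]
  -- The `p` residues `a` turn the local factor `1 / p ^ 2` into `1 / p`.
  rw [Finset.sum_const, Finset.card_univ, ZMod.card, nsmul_eq_mul]
  field_simp

end Limit

theorem multipliable_one_sub_one_div_pow {q : ℝ} (hq : 1 < q) :
    Multipliable fun i : ℕ => 1 - 1 / q ^ (i + 1) := by
  have hs : Summable fun i : ℕ => ‖-(1 / q ^ (i + 1))‖ := by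
    simp_rw [norm_neg, ← one_div_pow]
    refine Summable.norm ?_
    exact (summable_nat_add_iff 1).mpr (summable_geometric_of_lt_one (by positivity)
      (by rw [one_div]; exact inv_lt_one_of_one_lt₀ hq))
  simpa [sub_eq_add_neg] using multipliable_one_add_of_summable hs

theorem theoremB5 (p : ℕ) [Fact p.Prime]
    {Ω : ℕ → Type*} [∀ n, MeasurableSpace (Ω n)]
    (P : ∀ n, Measure (Ω n)) [∀ n, IsProbabilityMeasure (P n)]
    (M : ∀ n, Ω n → Matrix (Fin n) (Fin n) (ProfiniteCompletion ℤ[X]))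
    (ζ : ∀ n, Ω n → Fin n → ProfiniteCompletion ℤ[X])
    (hM : ∀ n, HasLaw (M n)
      (haarProbability (Matrix (Fin n) (Fin n) (ProfiniteCompletion ℤ[X]))) (P n))
    (hζ : ∀ n, HasLaw (ζ n) (haarProbability (Fin n → ProfiniteCompletion ℤ[X])) (P n))
    (hindep : ∀ n, IndepFun (M n) (ζ n) (P n)) :
    (∀ n, NullMeasurableSet {ω | ConditionW p (walkMatrix (M n ω) (ζ n ω)).Cokernel} (P n)) ∧
    Multipliable (fun i : ℕ => 1 - 1 / (p : ℝ) ^ (i + 1)) ∧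
    Tendsto (fun n => (P n).real {ω | ConditionW p (walkMatrix (M n ω) (ζ n ω)).Cokernel})
      atTop (𝓝 ((1 + 1 / (p : ℝ)) * ∏' i : ℕ, (1 - 1 / (p : ℝ) ^ (i + 1)))) := by
  have hp1 : (1 : ℝ) < p := by exact_mod_cast (Fact.out : p.Prime).one_lt
  have hmul := multipliable_one_sub_one_div_pow hp1
  have hpair (n : ℕ) : AEMeasurable (fun ω => (M n ω, ζ n ω)) (P n) :=
    (hM n).aemeasurable.prodMk (hζ n).aemeasurable
  have hlaw (n : ℕ) : (P n).map (fun ω => (M n ω, ζ n ω)) = haarPair n := by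
    rw [(indepFun_iff_map_prod_eq_prod_map_map (hM n).aemeasurable (hζ n).aemeasurable).mp
      (hindep n), (hM n).map_eq, (hζ n).map_eq]
  have hprob (n : ℕ) : (P n).real {ω | ConditionW p (walkMatrix (M n ω) (ζ n ω)).Cokernel} =
      (1 + 1 / (p : ℝ) * (1 - 1 / (p : ℝ) ^ n)) *
        ∏ i ∈ Finset.range n, (1 - 1 / (p : ℝ) ^ (i + 1)) := by
    rw [← haarPair_real_conditionW, ← hlaw, measureReal_def, measureReal_def,
      Measure.map_apply_of_aemeasurable (hpair n) measurableSet_conditionW]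
    rfl
  -- `M n` and `ζ n` are only almost everywhere measurable, so the preimage of a measurable set is
  -- null-measurable.
  refine ⟨fun n => (hpair n).nullMeasurableSet_preimage measurableSet_conditionW, hmul, ?_⟩
  simp_rw [hprob]
  refine Tendsto.mul ?_ hmul.hasProd.tendsto_prod_nat
  have h0 : Tendsto (fun n : ℕ => 1 / (p : ℝ) ^ n) atTop (𝓝 0) := by
    simp_rw [← one_div_pow]
    exact tendsto_pow_atTop_nhds_zero_of_lt_one (by positivity)
      (by rw [one_div]; exact inv_lt_one_of_one_lt₀ hp1)
  simpa using ((h0.const_sub 1).const_mul (1 / (p : ℝ))).const_add 1
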